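/- **Theorem 3.6.** Let $d\ne 1$ be a squarefree integer, $K=\mathbb{Q}(\sqrt d)$ with ring of integers $\mathcal{O}_K$, and put $\omega=\frac{1+\sqrt d}{2}$, $d_K=d$ if $d\equiv 1 \bmod 4$, and $\omega=\sqrt d$, $d_K=4d$ otherwise (with $\sqrt{d_K}=\sqrt d$, resp. $\sqrt{d_K}=2\sqrt d$). Let $\mathcal{O}$ be an order in $K$ (a subring of $\mathcal{O}_K$ with quotient field $K$ over which $\mathcal{O}_K$ is a finitely generated module) with conductor $\{x\in K\mid x\mathcal{O}_K\subseteq\mathcal{O}\}=f\mathcal{O}_K$, where $f\ge 2$ is an integer. Let $\varepsilon\in\{0,1\}$ with $\varepsilon\equiv f d_K \bmod 2$, and $\tau=\frac{\varepsilon+f\sqrt{d_K}}{2}$. Let $p$ be a prime divisor of $f$, $v=\mathrm{v}_p(f)$, $\mathfrak{p}=p\mathbb{Z}+f\omega\mathbb{Z}$ (an ideal of $\mathcal{O}$), and let $N=\mathcal{N}_{K/\mathbb{Q}}$ denote the norm. An *ideal atom* is an atom (irreducible element) of the monoid of nonzero ideals of $\mathcal{O}$ under multiplication. The prime $p$ is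 *inert* if $p\mathcal{O}_K$ is prime, *split* if $p\mathcal{O}_K$ is a product of two distinct prime ideals, and *ramified* if $p\mathcal{O}_K$ is the square of a prime ideal. 1. The primary ideals of $\mathcal{O}$ with radical $\mathfrak{p}$ are exactly the sets $\mathfrak{q}=p^\ell(p^m\mathbb{Z}+(r+\tau)\mathbb{Z})$ with integers $\ell,m\ge 0$, $\ell+m\ge 1$, $0\le r<p^m$ and $N(r+\tau)\equiv 0 \bmod p^m$ (all of these are ideals). Moreover $|\mathcal{O}/\mathfrak{q}|=p^{2\ell+m}$. 2. Let $\mathfrak{q}=p^\ell(p^m\mathbb{Z}+(r+\tau)\mathbb{Z})$, with integers $\ell,m\ge 0$ and $r$, be a primary ideal with radical $\mathfrak{p}$. If $m\ge 1$, then $\mathfrak{q}$ is invertible if and only if $N(r+\tau)\not\equiv 0 \bmod p^{m+1}$. If $m=0$, then $\mathfrak{q}$ is invertible. 3. A primary ideal $\mathfrak{q}$ with radical $\mathfrak{p}$ is an ideal atom if and only if $\mathfrak{q}=p\mathcal{O}$ or $\mathfrak{q}=p^m\mathbb{Z}+(r+\tau)\mathbb{Z}$ for some integers $m\ge 1$ and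 $r$ with $p^m\mid N(r+\tau)$. 4. For an integer $m\ge 0$ let $A_m$ be the number of invertible ideal atoms of norm $p^m$ (that is, with $|\mathcal{O}/\mathfrak{q}|=p^m$) which are of the form $\mathfrak{q}=p^m\mathbb{Z}+(r+\tau)\mathbb{Z}$ with $r\in\mathbb{Z}$. Then, with $\varphi$ denoting Euler's function: - $A_{2h}=\varphi(p^h)$ for $1\le h<v$, and $A_m=0$ for all other $m<2v$; - if $p$ is inert, then $A_{2v}=p^v$ and $A_m=0$ for all $m\ge 2v+1$; - if $p$ is ramified, then $A_{2v}=\varphi(p^v)$, $A_{2v+1}=p^v$ and $A_m=0$ for all $m>2v+1$; - if $p$ is split, then $A_{2v}=p^{v-1}(p-2)$ and $A_m=2\varphi(p^v)$ for all $m\ge 2v+1$. 5. The number of ideal atoms with radical $\mathfrak{p}$ is finite if and only if the number of invertible ideal atoms with radical $\mathfrak{p}$ is finite, if and only if $p$ is not split. -/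

import Mathlib

open scoped nonZeroDivisors

noncomputable section

namespace QuadOrder

/-- The discriminant `d_K` of `ℚ(√d)`, for `d` squarefree. -/
def dK (d : ℤ) : ℤ := if d % 4 = 1 then d else 4 * d

/-- `ε ∈ {0, 1}` with `ε ≡ f d_K mod 2`. -/
def eps (d : ℤ) (f : ℕ) : ℤ := ((f : ℤ) * dK d) % 2

section Field

variable {K : Type*} [Field K]

/-- `√d_K`, expressed through a square root `δ` of `d`. -/
def sqrtDK (d : ℤ) (δ : K) : K := if d % 4 = 1 then δ else 2 * δ

/-- `ω = (1 + √d) / 2` if `d ≡ 1 mod 4`, and `ω = √d` otherwise; `δ` is a square root of `d`. -/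
def omega (d : ℤ) (δ : K) : K := if d % 4 = 1 then (1 + δ) / 2 else δ

/-- `τ = (ε + f √d_K) / 2`. -/
def tau (d : ℤ) (δ : K) (f : ℕ) : K := ((eps d f : K) + (f : K) * sqrtDK d δ) / 2

/-- The set `aℤ + bℤ`. -/
def lattice (a b : K) : Set K := {x | ∃ s t : ℤ, x = a * s + b * t}

/-- The set `p^ℓ (p^m ℤ + (r + τ) ℤ)`. -/
def primaryLattice (p : ℕ) (τ : K) (l m : ℕ) (r : ℤ) : Set K :=
  {x | ∃ y ∈ lattice ((p : K) ^ m) ((r : K) + τ), x = (p : K) ^ l * y}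

/-- `O` is an order in the maximal order `O_K`: it is a subring of `O_K` with quotient field `K`,
and `O_K` is a finitely generated `O`-module. -/
structure IsOrder (O : Subring K) : Prop where
  le : O ≤ (integralClosure ℤ K).toSubring
  quotient_field : ∀ x : K, ∃ a ∈ O, ∃ b ∈ O, b ≠ 0 ∧ x = a / b
  finite : ∃ S : Finset K, (Submodule.span O (S : Set K) : Set K) = {x : K | IsIntegral ℤ x}

/-- The conductor `(O : O_K) = {x ∈ K | x O_K ⊆ O}`. -/
def conductor (O : Subring K) : Set K := {x | ∀ y : K, IsIntegral ℤ y → x * y ∈ O}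

/-- The conductor of `O` is `f O_K`. -/
def HasConductor (O : Subring K) (f : ℕ) : Prop :=
  conductor O = {x : K | ∃ y : K, IsIntegral ℤ y ∧ x = (f : K) * y}

/-- `N_{K/ℚ}(x) ≡ 0 mod n`: the norm is an integer multiple of `n`. -/
def NormDvd [NumberField K] (n : ℕ) (x : K) : Prop :=
  ∃ k : ℤ, Algebra.norm ℚ x = ((n : ℚ) * (k : ℚ))

/-- An ideal of a subring of `K`, as a subset of `K`. -/
def carrier {O : Subring K} (I : Ideal O) : Set K := Subtype.val '' (I : Set O)

end Field

/-- An ideal of a domain is invertible if it is a unit among the fractional ideals. -/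
def Invertible {R : Type*} [CommRing R] [IsDomain R] (I : Ideal R) : Prop :=
  IsUnit (I : FractionalIdeal R⁰ (FractionRing R))

/-- Atoms of the monoid of nonzero ideals of a domain. (The factors of a nonzero ideal are nonzero,
so irreducibility among all ideals is irreducibility among the nonzero ones.) -/
def IsIdealAtom {R : Type*} [CommRing R] [IsDomain R] (I : Ideal R) : Prop :=
  I ≠ ⊥ ∧ Irreducible I

/-- The norm `|R / I|` of an ideal. -/
def idealNorm {R : Type*} [CommRing R] (I : Ideal R) : ℕ := Nat.card (R ⧸ I)

section Splitting

variable (K : Type*) [Field K] [NumberField K]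

/-- The ideal `p O_K`. -/
def extended (p : ℕ) : Ideal (NumberField.RingOfIntegers K) :=
  Ideal.span {(p : NumberField.RingOfIntegers K)}

/-- `p O_K` is a prime ideal. -/
def Inert (p : ℕ) : Prop := (extended K p).IsPrime

/-- `p O_K` is a product of two distinct prime ideals. -/
def Splits (p : ℕ) : Prop :=
  ∃ P Q : Ideal (NumberField.RingOfIntegers K), P.IsPrime ∧ Q.IsPrime ∧ P ≠ Q ∧
    extended K p = P * Q

/-- `p O_K` is the square of a prime ideal. -/
def Ramified (p : ℕ) : Prop :=
  ∃ P : Ideal (NumberField.RingOfIntegers K), P.IsPrime ∧ extended K p = P ^ 2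

end Splitting

/-- The invertible ideal atoms of the form `p^m ℤ + (r + τ) ℤ` with norm `p^m`. -/
def invAtoms {K : Type*} [Field K] (O : Subring K) (p : ℕ) (τ : K) (m : ℕ) : Set (Ideal O) :=
  {I | IsIdealAtom I ∧ Invertible I ∧ idealNorm I = p ^ m ∧
    ∃ r : ℤ, carrier I = primaryLattice p τ 0 m r}

end QuadOrder

end

/-!
Write `O = ℤ[θ]` and `F(x) = N(x + θ)`, a monic quadratic polynomial over `ℤ`. An ideal whose
radical is `𝔭` has the form `p^ℓ (p^m ℤ + (x + θ) ℤ)` with `p^m ∣ F(x)`, and for `m ≥ 1` it is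
invertible exactly when `p^(m+1) ∤ F(x)`. A product of two such ideals lies in `𝔭² ⊆ pO`, which
contains no `x + θ`; hence every such ideal with `ℓ = 0` is an atom, and the invertible atoms of
norm `p^m` correspond to the residues `x` modulo `p^m` with `p^m` exactly dividing `F(x)`.

After a translation, `F(x) = x² + f t x + f² n` with `t` and `n` the trace and norm of `ω`. Writing
`f = p^v g` and `x = p^v u` reduces the count for `m ≥ 2v` to the polynomial `u² + g t u + g² n`. It
has no root, a double root or two simple roots modulo `p` according to whether `p` is inert,
ramified or split. A double root does not lift modulo `p²`, because the prime of `O_K` over `p` is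
invertible, whereas simple roots lift to all powers of `p` by Hensel's lemma.
-/

namespace QuadOrder

/-! ### Roots of quadratic polynomials modulo prime powers -/

/-- The value at `x` of the monic quadratic polynomial `x² + T x + N`, which is the norm of `x + θ`
when `θ` has trace `T` and norm `N`. -/
def normForm (T N x : ℤ) : ℤ := x ^ 2 + T * x + N

/-- The residues `x` modulo `p ^ n` for which `p ^ k` is the exact power of `p` in
`x² + T x + N`. -/
noncomputable def exactRoots (p : ℕ) (T N : ℤ) (n k : ℕ) : Finset ℤ :=
  {x ∈ Finset.Ico 0 ((p : ℤ) ^ n) |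
    (p : ℤ) ^ k ∣ normForm T N x ∧ ¬ (p : ℤ) ^ (k + 1) ∣ normForm T N x}

theorem mem_exactRoots {p : ℕ} {T N x : ℤ} {n k : ℕ} :
    x ∈ exactRoots p T N n k ↔ (0 ≤ x ∧ x < (p : ℤ) ^ n) ∧
      (p : ℤ) ^ k ∣ normForm T N x ∧ ¬ (p : ℤ) ^ (k + 1) ∣ normForm T N x := by
  rw [exactRoots, Finset.mem_filter, Finset.mem_Ico]

theorem normForm_mul (T N c x : ℤ) :
    normForm (c * T) (c ^ 2 * N) (c * x) = c ^ 2 * normForm T N x := by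
  unfold normForm; ring

theorem normForm_add (T N x y : ℤ) :
    normForm T N (x + y) = normForm (2 * x + T) (normForm T N x) y := by
  unfold normForm; ring

theorem normForm_neg_sub (T N x : ℤ) : normForm T N (-x - T) = normForm T N x := by
  unfold normForm; ring

theorem dvd_normForm_iff_of_dvd_sub {T N x y a : ℤ} (h : a ∣ y - x) :
    a ∣ normForm T N y ↔ a ∣ normForm T N x := by
  have e : normForm T N y - normForm T N x = (y - x) * (y + x + T) := by unfold normForm; ring
  exact dvd_iff_dvd_of_dvd_sub (e ▸ h.mul_right _)

/-- In other words, `x / c` is an integer as soon as it is integral over `ℤ`. -/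
theorem dvd_of_sq_dvd_normForm {T N c x : ℤ} (h : c ^ 2 ∣ normForm (c * T) (c ^ 2 * N) x) :
    c ∣ x := by
  rcases (Int.gcd c x).eq_zero_or_pos with h0 | h0
  · rw [(Int.gcd_eq_zero_iff.mp h0).2]
    exact dvd_zero c
  obtain ⟨c', x', hcop, hc, hx⟩ := Int.exists_gcd_one h0
  set g : ℤ := (Int.gcd c x : ℤ)
  have hg : g ^ 2 ≠ 0 := pow_ne_zero 2 (Int.natCast_ne_zero.mpr h0.ne')
  have e : normForm (c * T) (c ^ 2 * N) x = g ^ 2 * (x' ^ 2 + c' * (T * x' + c' * N)) := by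
    rw [hc, hx]; unfold normForm; ring
  have h1 : c' ∣ x' ^ 2 + c' * (T * x' + c' * N) := by
    rw [e, hc, mul_comm c' g, mul_pow] at h
    exact (dvd_pow_self c' two_ne_zero).trans (Int.dvd_of_mul_dvd_mul_left hg h)
  have h2 : IsUnit c' :=
    (Int.isCoprime_iff_gcd_eq_one.mpr hcop).symm.pow_left.isUnit_of_dvd'
      ((dvd_add_left (dvd_mul_right c' _)).mp h1) (dvd_refl c')
  rw [hc, hx]
  exact mul_dvd_mul_right (h2.dvd) g

theorem not_pow_dvd_normForm_mul {p : ℕ} (hp : p.Prime) {g : ℤ} (hg : ¬ (p : ℤ) ∣ g)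
    {T N : ℤ} {i : ℕ} (h : ∀ u, ¬ (p : ℤ) ^ i ∣ normForm T N u) (u : ℤ) :
    ¬ (p : ℤ) ^ i ∣ normForm (g * T) (g ^ 2 * N) u := by
  have hcop : IsCoprime g ((p : ℤ) ^ i) :=
    ((Prime.coprime_iff_not_dvd (Nat.prime_iff_prime_int.mp hp)).mpr hg).symm.pow_right
  have ⟨s, w, hs⟩ := hcop
  have hsub : (p : ℤ) ^ i ∣ g * (s * u) - u :=
    ⟨-(w * u), by linear_combination u * hs⟩
  rw [← dvd_normForm_iff_of_dvd_sub hsub, normForm_mul]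
  exact fun h' => h _ (hcop.symm.pow_right.dvd_of_dvd_mul_left h')

theorem not_pow_dvd_normForm_pow_mul {p : ℕ} (hp : p.Prime) {T N : ℤ} {v i : ℕ}
    (h : ∀ u, ¬ (p : ℤ) ^ i ∣ normForm T N u) (u : ℤ) :
    ¬ (p : ℤ) ^ (2 * v + i) ∣ normForm ((p : ℤ) ^ v * T) (((p : ℤ) ^ v) ^ 2 * N) u := by
  intro hu
  have hpow : (p : ℤ) ^ (2 * v + i) = ((p : ℤ) ^ v) ^ 2 * (p : ℤ) ^ i := by ring
  rw [hpow] at hu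
  obtain ⟨u, rfl⟩ := dvd_of_sq_dvd_normForm (dvd_of_mul_right_dvd hu)
  rw [normForm_mul] at hu
  exact h u ((mul_dvd_mul_iff_left (by simp [hp.ne_zero])).mp hu)

theorem card_exactRoots_pow_mul {p : ℕ} (hp : p.Prime) (T N : ℤ) (v n k : ℕ) :
    (exactRoots p ((p : ℤ) ^ v * T) (((p : ℤ) ^ v) ^ 2 * N) (v + n) (2 * v + k)).card =
      (exactRoots p T N n k).card := by
  have hpos : (0 : ℤ) < (p : ℤ) ^ v := pow_pos (by exact_mod_cast hp.pos) v
  have hpow : ∀ i, (p : ℤ) ^ (2 * v + i) = ((p : ℤ) ^ v) ^ 2 * (p : ℤ) ^ i := fun i => by ring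
  have hmem : ∀ u, (p : ℤ) ^ v * u ∈
      exactRoots p ((p : ℤ) ^ v * T) (((p : ℤ) ^ v) ^ 2 * N) (v + n) (2 * v + k) ↔
        u ∈ exactRoots p T N n k := fun u => by
    simp only [mem_exactRoots, normForm_mul, add_assoc, hpow, pow_add _ v n,
      mul_lt_mul_iff_right₀ hpos, mul_nonneg_iff_of_pos_left hpos,
      mul_dvd_mul_iff_left (pow_pos hpos 2).ne']
  rw [← Finset.card_image_of_injective (exactRoots p T N n k) (mul_right_injective₀ hpos.ne')]
  congr 1
  ext x
  rw [Finset.mem_image]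
  constructor
  · intro hx
    have hdvd := (Dvd.intro _ (hpow k).symm).trans (mem_exactRoots.mp hx).2.1
    obtain ⟨u, rfl⟩ := dvd_of_sq_dvd_normForm hdvd
    exact ⟨u, (hmem u).mp hx, rfl⟩
  · rintro ⟨u, hu, rfl⟩
    exact (hmem u).mpr hu

theorem card_Ico_zero_pow (p k : ℕ) : (Finset.Ico 0 ((p : ℤ) ^ k)).card = p ^ k := by
  rw [Int.card_Ico, sub_zero, ← Nat.cast_pow, Int.toNat_natCast]

theorem card_Ico_filter_dvd_sub {p : ℕ} (hp : p.Prime) {j k : ℕ} (hjk : j ≤ k) (a : ℤ) :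
    {u ∈ Finset.Ico 0 ((p : ℤ) ^ k) | (p : ℤ) ^ j ∣ u - a}.card = p ^ (k - j) := by
  have hpos : (0 : ℤ) < (p : ℤ) ^ j := pow_pos (by exact_mod_cast hp.pos) j
  obtain ⟨i, rfl⟩ := Nat.exists_eq_add_of_le hjk
  have hceil : (((p : ℤ) ^ (j + i) : ℤ) - a : ℚ) / (((p : ℤ) ^ j : ℤ) : ℚ) =
      ((0 : ℤ) - a : ℚ) / (((p : ℤ) ^ j : ℤ) : ℚ) + (((p : ℤ) ^ i : ℤ) : ℚ) := by
    have hne : ((p : ℚ)) ^ j ≠ 0 := by exact_mod_cast hpos.ne'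
    push_cast
    field_simp
    ring
  have h := Int.Ico_filter_modEq_card 0 ((p : ℤ) ^ (j + i)) hpos a
  rw [hceil, Int.ceil_add_intCast, add_sub_cancel_left,
    max_eq_left (pow_nonneg (by exact_mod_cast hp.pos.le) i)] at h
  rw [Nat.add_sub_cancel_left, Finset.filter_congr fun u _ =>
    (Int.modEq_iff_dvd.symm.trans Int.modEq_comm : (p : ℤ) ^ j ∣ u - a ↔ u ≡ a [ZMOD p ^ j])]
  exact_mod_cast h

theorem card_Ico_filter_not_dvd_sub {p : ℕ} (hp : p.Prime) {k : ℕ} (hk : 1 ≤ k) (a : ℤ) :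
    {u ∈ Finset.Ico 0 ((p : ℤ) ^ k) | ¬ (p : ℤ) ∣ u - a}.card = Nat.totient (p ^ k) := by
  have hdvd := card_Ico_filter_dvd_sub hp hk a
  have hsum := Finset.card_filter_add_card_filter_not (s := Finset.Ico 0 ((p : ℤ) ^ k))
    (fun u => (p : ℤ) ∣ u - a)
  rw [pow_one] at hdvd
  rw [card_Ico_zero_pow, hdvd] at hsum
  rw [Nat.totient_prime_pow hp hk, Nat.mul_sub, pow_sub_one_mul (by omega), mul_one]
  omega

theorem exactRoots_eq_empty_of_not_dvd {p : ℕ} {T N : ℤ} {i k : ℕ} (hik : i ≤ k)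
    (h : ∀ u, ¬ (p : ℤ) ^ i ∣ normForm T N u) (n : ℕ) : exactRoots p T N n k = ∅ :=
  Finset.filter_false_of_mem fun u _ hu => h u ((pow_dvd_pow _ hik).trans hu.1)

theorem exactRoots_zero_zero {p : ℕ} {T N : ℤ} (h : (p : ℤ) ∣ N) : exactRoots p T N 0 0 = ∅ := by
  refine Finset.eq_empty_of_forall_notMem fun u hu => ?_
  obtain ⟨⟨hu0, hu1⟩, -, hu⟩ := mem_exactRoots.mp hu
  obtain rfl : u = 0 := by rw [pow_zero] at hu1; omega
  exact hu (by simpa [normForm] using h)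

theorem card_exactRoots_zero_of_no_root {p : ℕ} {T N : ℤ}
    (h : ∀ u, ¬ (p : ℤ) ∣ normForm T N u) (n : ℕ) : (exactRoots p T N n 0).card = p ^ n := by
  rw [exactRoots, Finset.filter_true_of_mem fun u _ => by simpa using h u, card_Ico_zero_pow]

theorem dvd_normForm_iff_of_double_root {p : ℕ} (hp : p.Prime) {T N a : ℤ}
    (ha : (p : ℤ) ∣ normForm T N a) (ha' : (p : ℤ) ∣ 2 * a + T) (u : ℤ) :
    (p : ℤ) ∣ normForm T N u ↔ (p : ℤ) ∣ u - a := by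
  have hpp : Prime (p : ℤ) := Nat.prime_iff_prime_int.mp hp
  have e : normForm T N u = (u - a) ^ 2 + ((u - a) * (2 * a + T) + normForm T N a) := by
    unfold normForm; ring
  rw [e, dvd_add_left ((ha'.mul_left _).add ha), hpp.dvd_pow_iff_dvd two_ne_zero]

theorem card_exactRoots_zero_of_double_root {p : ℕ} (hp : p.Prime) {T N a : ℤ}
    (ha : (p : ℤ) ∣ normForm T N a) (ha' : (p : ℤ) ∣ 2 * a + T) {n : ℕ} (hn : 1 ≤ n) :
    (exactRoots p T N n 0).card = Nat.totient (p ^ n) := by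
  rw [← card_Ico_filter_not_dvd_sub hp hn a, exactRoots]
  simp only [pow_zero, isUnit_one, IsUnit.dvd, zero_add, pow_one, true_and,
    dvd_normForm_iff_of_double_root hp ha ha']

theorem card_exactRoots_one_of_double_root {p : ℕ} (hp : p.Prime) {T N a : ℤ}
    (ha : (p : ℤ) ∣ normForm T N a) (ha' : (p : ℤ) ∣ 2 * a + T)
    (h2 : ∀ u, ¬ (p : ℤ) ^ 2 ∣ normForm T N u) (n : ℕ) :
    (exactRoots p T N (n + 1) 1).card = p ^ n := by
  rw [exactRoots, ← Nat.add_sub_cancel (n := n) (m := 1),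
    ← card_Ico_filter_dvd_sub hp (Nat.le_add_left 1 n) a]
  simp only [pow_one, one_add_one_eq_two, h2, not_false_eq_true, and_true,
    dvd_normForm_iff_of_double_root hp ha ha', Nat.add_sub_cancel]

theorem exists_lift_of_simple_root {p : ℕ} (hp : p.Prime) {T N a : ℤ}
    (ha : (p : ℤ) ∣ normForm T N a) (ha' : ¬ (p : ℤ) ∣ 2 * a + T) (k : ℕ) :
    ∃ b, (p : ℤ) ^ (k + 1) ∣ normForm T N b ∧ ¬ (p : ℤ) ∣ 2 * b + T := by
  have hpp : Prime (p : ℤ) := Nat.prime_iff_prime_int.mp hp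
  induction k with
  | zero => exact ⟨a, by simpa using ha, ha'⟩
  | succ k ih =>
    obtain ⟨b, ⟨c, hc⟩, hb⟩ := ih
    obtain ⟨s, t, hst⟩ : IsCoprime (2 * b + T) (p : ℤ) :=
      ((Prime.coprime_iff_not_dvd hpp).mpr hb).symm
    -- The Newton step `b - F(b) / F'(b)`, with `s` an inverse of `F'(b)` modulo `p`.
    refine ⟨b - (p : ℤ) ^ (k + 1) * (c * s), ⟨c * t + (p : ℤ) ^ k * (c * s) ^ 2, ?_⟩, ?_⟩
    · have e : normForm T N (b - (p : ℤ) ^ (k + 1) * (c * s)) = normForm T N b -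
          (p : ℤ) ^ (k + 1) * (c * (s * (2 * b + T))) +
            (p : ℤ) ^ (k + 1 + (k + 1)) * (c * s) ^ 2 := by
        unfold normForm; ring
      rw [e, hc, eq_sub_of_add_eq hst]
      ring
    · have e : 2 * (b - (p : ℤ) ^ (k + 1) * (c * s)) + T =
          (2 * b + T) - p * (2 * (p : ℤ) ^ k * (c * s)) := by ring
      rwa [e, dvd_sub_left (dvd_mul_right _ _)]

theorem pow_dvd_normForm_iff_of_simple_root {p : ℕ} (hp : p.Prime) {T N a : ℤ} {i : ℕ}
    (ha : (p : ℤ) ^ i ∣ normForm T N a) (ha' : ¬ (p : ℤ) ∣ 2 * a + T) (u : ℤ) :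
    (p : ℤ) ^ i ∣ normForm T N u ↔ (p : ℤ) ^ i ∣ u - a ∨ (p : ℤ) ^ i ∣ u - (-T - a) := by
  have hpp : Prime (p : ℤ) := Nat.prime_iff_prime_int.mp hp
  have e : normForm T N u = (u - a) * (u - (-T - a)) + normForm T N a := by
    unfold normForm; ring
  have ediff : u - (-T - a) - (u - a) = 2 * a + T := by ring
  rw [e, dvd_add_left ha]
  refine ⟨fun h => ?_, fun h => h.elim (·.mul_right _) (·.mul_left _)⟩
  by_cases h1 : (p : ℤ) ∣ u - a
  · exact Or.inl (hpp.pow_dvd_of_dvd_mul_right i (fun h2 => ha' (ediff ▸ dvd_sub h2 h1)) h)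
  · exact Or.inr (hpp.pow_dvd_of_dvd_mul_left i h1 h)

theorem card_filter_pow_dvd_of_simple_root {p : ℕ} (hp : p.Prime) {T N a : ℤ}
    (ha : (p : ℤ) ∣ normForm T N a) (ha' : ¬ (p : ℤ) ∣ 2 * a + T) {i n : ℕ} (hin : i + 1 ≤ n) :
    {u ∈ Finset.Ico 0 ((p : ℤ) ^ n) | (p : ℤ) ^ (i + 1) ∣ normForm T N u}.card =
      2 * p ^ (n - (i + 1)) := by
  obtain ⟨b, hb, hb'⟩ := exists_lift_of_simple_root hp ha ha' i
  simp only [pow_dvd_normForm_iff_of_simple_root hp hb hb']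
  rw [Finset.filter_or, Finset.card_union_of_disjoint, card_Ico_filter_dvd_sub hp hin,
    card_Ico_filter_dvd_sub hp hin, two_mul]
  refine Finset.disjoint_filter.mpr fun u _ h1 h2 => hb' ?_
  have e : u - (-T - b) - (u - b) = 2 * b + T := by ring
  exact (dvd_pow_self _ i.succ_ne_zero).trans (e ▸ dvd_sub h2 h1)

theorem card_exactRoots_eq_sub (p : ℕ) (T N : ℤ) (n k : ℕ) :
    (exactRoots p T N n k).card =
      {u ∈ Finset.Ico 0 ((p : ℤ) ^ n) | (p : ℤ) ^ k ∣ normForm T N u}.card -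
      {u ∈ Finset.Ico 0 ((p : ℤ) ^ n) | (p : ℤ) ^ (k + 1) ∣ normForm T N u}.card := by
  rw [← Finset.card_sdiff_of_subset, ← Finset.filter_and_not]
  · rfl
  · exact Finset.monotone_filter_right _ fun u _ h => (pow_dvd_pow _ k.le_succ).trans h

theorem card_exactRoots_zero_of_simple_root {p : ℕ} (hp : p.Prime) {T N a : ℤ}
    (ha : (p : ℤ) ∣ normForm T N a) (ha' : ¬ (p : ℤ) ∣ 2 * a + T) {n : ℕ} (hn : 1 ≤ n) :
    (exactRoots p T N n 0).card = p ^ (n - 1) * (p - 2) := by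
  rw [card_exactRoots_eq_sub, card_filter_pow_dvd_of_simple_root hp ha ha' hn,
    Finset.filter_true_of_mem (by simp), card_Ico_zero_pow, Nat.mul_sub,
    pow_sub_one_mul (by omega), mul_comm 2, zero_add]

theorem card_exactRoots_of_simple_root {p : ℕ} (hp : p.Prime) {T N a : ℤ}
    (ha : (p : ℤ) ∣ normForm T N a) (ha' : ¬ (p : ℤ) ∣ 2 * a + T) {n k : ℕ} (hn : 1 ≤ n)
    (hk : 1 ≤ k) : (exactRoots p T N (n + k) k).card = 2 * Nat.totient (p ^ n) := by
  obtain ⟨k, rfl⟩ := Nat.exists_eq_add_of_le' hk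
  rw [card_exactRoots_eq_sub, card_filter_pow_dvd_of_simple_root hp ha ha' (by omega),
    card_filter_pow_dvd_of_simple_root hp ha ha' (by omega), Nat.totient_prime_pow hp hn,
    ← Nat.mul_sub, Nat.mul_sub _ p, pow_sub_one_mul (by omega), mul_one,
    show n + (k + 1) - (k + 1) = n by omega, show n + (k + 1) - (k + 1 + 1) = n - 1 by omega]

theorem card_exactRoots_two_mul {p : ℕ} (hp : p.Prime) {h v : ℕ} (h1 : 1 ≤ h) (hv : h < v)
    (T N : ℤ) : (exactRoots p ((p : ℤ) ^ v * T) (((p : ℤ) ^ v) ^ 2 * N) (2 * h) (2 * h)).card =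
      Nat.totient (p ^ h) := by
  obtain ⟨i, rfl⟩ := Nat.exists_eq_add_of_lt hv
  have key := card_exactRoots_pow_mul hp ((p : ℤ) ^ (i + 1) * T) (((p : ℤ) ^ (i + 1)) ^ 2 * N) h h 0
  have hroot : (p : ℤ) ∣ normForm ((p : ℤ) ^ (i + 1) * T) (((p : ℤ) ^ (i + 1)) ^ 2 * N) 0 :=
    ⟨p ^ (2 * i + 1) * N, by unfold normForm; ring⟩
  rw [card_exactRoots_zero_of_double_root hp hroot ⟨p ^ i * T, by ring⟩ h1] at key
  simpa only [← mul_assoc, ← mul_pow, ← pow_add, ← two_mul, add_zero, add_assoc] using key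

theorem exactRoots_two_mul_add_one_eq_empty {p : ℕ} (hp : p.Prime) {j v : ℕ} (hj : j < v)
    (T N : ℤ) :
    exactRoots p ((p : ℤ) ^ v * T) (((p : ℤ) ^ v) ^ 2 * N) (2 * j + 1) (2 * j + 1) = ∅ := by
  obtain ⟨i, rfl⟩ := Nat.exists_eq_add_of_lt hj
  have key := card_exactRoots_pow_mul hp ((p : ℤ) ^ (i + 1) * T) (((p : ℤ) ^ (i + 1)) ^ 2 * N)
    j (j + 1) 1
  have hempty :
      exactRoots p ((p : ℤ) ^ (i + 1) * T) (((p : ℤ) ^ (i + 1)) ^ 2 * N) (j + 1) 1 = ∅ := by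
    refine Finset.filter_false_of_mem fun u _ ⟨h1, h2⟩ => h2 ?_
    have e : normForm ((p : ℤ) ^ (i + 1) * T) (((p : ℤ) ^ (i + 1)) ^ 2 * N) u =
        u ^ 2 + p * (p ^ i * T * u + p ^ (2 * i + 1) * N) := by unfold normForm; ring
    rw [pow_one, e, dvd_add_left (dvd_mul_right _ _)] at h1
    obtain ⟨w, rfl⟩ := (Nat.prime_iff_prime_int.mp hp).dvd_of_dvd_pow h1
    exact ⟨w ^ 2 + p ^ i * T * w + p ^ (2 * i) * N, by rw [e]; ring⟩
  rw [hempty, Finset.card_empty, Finset.card_eq_zero] at key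
  simpa only [← mul_assoc, ← mul_pow, ← pow_add, ← two_mul, ← add_assoc] using key

section Conductor

variable {p f : ℕ} {t n x : ℤ}

theorem exists_conductor_eq (hp : p.Prime) (hf : f ≠ 0) :
    ∃ g : ℤ, ¬ (p : ℤ) ∣ g ∧ ∀ t n : ℤ, f * t = (p : ℤ) ^ padicValNat p f * (g * t) ∧
      f ^ 2 * n = ((p : ℤ) ^ padicValNat p f) ^ 2 * (g ^ 2 * n) := by
  have := Fact.mk hp
  obtain ⟨g, hg⟩ : p ^ padicValNat p f ∣ f := pow_padicValNat_dvd
  have hg' : (f : ℤ) = (p : ℤ) ^ padicValNat p f * g := by exact_mod_cast hg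
  refine ⟨g, fun h => pow_succ_padicValNat_not_dvd (p := p) hf ?_, fun t n => ?_⟩
  · nth_rewrite 2 [hg]
    exact mul_dvd_mul_left _ (by exact_mod_cast h)
  · generalize (p : ℤ) ^ padicValNat p f = c at hg' ⊢
    rw [hg']
    constructor <;> ring

theorem not_pow_dvd_normForm_conductor_mul (hp : p.Prime) (hf : f ≠ 0) {i : ℕ}
    (h : ∀ u, ¬ (p : ℤ) ^ i ∣ normForm t n u) (u : ℤ) :
    ¬ (p : ℤ) ^ (2 * padicValNat p f + i) ∣ normForm (f * t) (f ^ 2 * n) u := by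
  obtain ⟨g, hg, hfg⟩ := exists_conductor_eq hp hf
  rw [(hfg t n).1, (hfg t n).2]
  exact not_pow_dvd_normForm_pow_mul hp (not_pow_dvd_normForm_mul hp hg h) u

theorem exactRoots_conductor_eq_empty (hp : p.Prime) (hf : f ≠ 0) {i m : ℕ}
    (h : ∀ u, ¬ (p : ℤ) ^ i ∣ normForm t n u) (hm : 2 * padicValNat p f + i ≤ m) :
    exactRoots p (f * t) (f ^ 2 * n) m m = ∅ :=
  exactRoots_eq_empty_of_not_dvd hm (not_pow_dvd_normForm_conductor_mul hp hf h) m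

theorem card_exactRoots_conductor (hp : p.Prime) (hf : f ≠ 0) :
    ∃ g : ℤ, ¬ (p : ℤ) ∣ g ∧ ∀ (t n : ℤ) (k : ℕ), (exactRoots p (f * t) (f ^ 2 * n)
      (2 * padicValNat p f + k) (2 * padicValNat p f + k)).card =
        (exactRoots p (g * t) (g ^ 2 * n) (padicValNat p f + k) k).card := by
  obtain ⟨g, hg, hfg⟩ := exists_conductor_eq hp hf
  refine ⟨g, hg, fun t n k => ?_⟩
  have h := card_exactRoots_pow_mul hp (g * t) (g ^ 2 * n) (padicValNat p f) (padicValNat p f + k) k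
  rwa [← add_assoc, ← two_mul, ← (hfg t n).1, ← (hfg t n).2] at h

theorem card_exactRoots_conductor_of_no_root (hp : p.Prime) (hf : f ≠ 0)
    (h : ∀ u, ¬ (p : ℤ) ∣ normForm t n u) :
    (exactRoots p (f * t) (f ^ 2 * n) (2 * padicValNat p f) (2 * padicValNat p f)).card =
      p ^ padicValNat p f := by
  obtain ⟨g, hg, hcard⟩ := card_exactRoots_conductor hp hf
  rw [← card_exactRoots_zero_of_no_root (fun u => ?_)]
  · exact hcard t n 0
  · simpa using not_pow_dvd_normForm_mul hp hg (i := 1) (by simpa using h) u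

theorem double_root_mul (hx : (p : ℤ) ∣ normForm t n x) (hx' : (p : ℤ) ∣ 2 * x + t) (g : ℤ) :
    (p : ℤ) ∣ normForm (g * t) (g ^ 2 * n) (g * x) ∧ (p : ℤ) ∣ 2 * (g * x) + g * t := by
  have e : 2 * (g * x) + g * t = g * (2 * x + t) := by ring
  rw [normForm_mul, e]
  exact ⟨hx.mul_left _, hx'.mul_left g⟩

theorem simple_root_mul (hp : p.Prime) (hx : (p : ℤ) ∣ normForm t n x)
    (hx' : ¬ (p : ℤ) ∣ 2 * x + t) {g : ℤ} (hg : ¬ (p : ℤ) ∣ g) :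
    (p : ℤ) ∣ normForm (g * t) (g ^ 2 * n) (g * x) ∧ ¬ (p : ℤ) ∣ 2 * (g * x) + g * t := by
  have e : 2 * (g * x) + g * t = g * (2 * x + t) := by ring
  rw [normForm_mul, e]
  exact ⟨hx.mul_left _, (Nat.prime_iff_prime_int.mp hp).not_dvd_mul hg hx'⟩

theorem card_exactRoots_conductor_of_double_root (hp : p.Prime) (hf : f ≠ 0) (hpf : p ∣ f)
    (hx : (p : ℤ) ∣ normForm t n x) (hx' : (p : ℤ) ∣ 2 * x + t) :
    (exactRoots p (f * t) (f ^ 2 * n) (2 * padicValNat p f) (2 * padicValNat p f)).card =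
      Nat.totient (p ^ padicValNat p f) := by
  have := Fact.mk hp
  obtain ⟨g, -, hcard⟩ := card_exactRoots_conductor hp hf
  obtain ⟨hgx, hgx'⟩ := double_root_mul hx hx' g
  exact (hcard t n 0).trans (card_exactRoots_zero_of_double_root hp hgx hgx'
    (one_le_padicValNat_of_dvd hf hpf))

theorem card_exactRoots_conductor_add_one_of_double_root (hp : p.Prime) (hf : f ≠ 0)
    (hx : (p : ℤ) ∣ normForm t n x) (hx' : (p : ℤ) ∣ 2 * x + t)
    (h2 : ∀ u, ¬ (p : ℤ) ^ 2 ∣ normForm t n u) :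
    (exactRoots p (f * t) (f ^ 2 * n) (2 * padicValNat p f + 1) (2 * padicValNat p f + 1)).card =
      p ^ padicValNat p f := by
  obtain ⟨g, hg, hcard⟩ := card_exactRoots_conductor hp hf
  obtain ⟨hgx, hgx'⟩ := double_root_mul hx hx' g
  rw [hcard, card_exactRoots_one_of_double_root hp hgx hgx' (not_pow_dvd_normForm_mul hp hg h2)]

theorem card_exactRoots_conductor_of_simple_root (hp : p.Prime) (hf : f ≠ 0) (hpf : p ∣ f)
    (hx : (p : ℤ) ∣ normForm t n x) (hx' : ¬ (p : ℤ) ∣ 2 * x + t) :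
    (exactRoots p (f * t) (f ^ 2 * n) (2 * padicValNat p f) (2 * padicValNat p f)).card =
      p ^ (padicValNat p f - 1) * (p - 2) := by
  have := Fact.mk hp
  obtain ⟨g, hg, hcard⟩ := card_exactRoots_conductor hp hf
  obtain ⟨hgx, hgx'⟩ := simple_root_mul hp hx hx' hg
  exact (hcard t n 0).trans (card_exactRoots_zero_of_simple_root hp hgx hgx'
    (one_le_padicValNat_of_dvd hf hpf))

theorem card_exactRoots_conductor_of_simple_root_of_lt (hp : p.Prime) (hf : f ≠ 0) (hpf : p ∣ f)
    (hx : (p : ℤ) ∣ normForm t n x) (hx' : ¬ (p : ℤ) ∣ 2 * x + t) {m : ℕ}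
    (hm : 2 * padicValNat p f < m) :
    (exactRoots p (f * t) (f ^ 2 * n) m m).card = 2 * Nat.totient (p ^ padicValNat p f) := by
  have := Fact.mk hp
  obtain ⟨g, hg, hcard⟩ := card_exactRoots_conductor hp hf
  obtain ⟨hgx, hgx'⟩ := simple_root_mul hp hx hx' hg
  obtain ⟨k, rfl⟩ := Nat.exists_eq_add_of_lt hm
  rw [add_assoc, hcard, card_exactRoots_of_simple_root hp hgx hgx'
    (one_le_padicValNat_of_dvd hf hpf) (Nat.le_add_left 1 k)]

theorem card_exactRoots_conductor_two_mul (hp : p.Prime) (hf : f ≠ 0) {h : ℕ} (h1 : 1 ≤ h)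
    (hv : h < padicValNat p f) (t n : ℤ) :
    (exactRoots p (f * t) (f ^ 2 * n) (2 * h) (2 * h)).card = Nat.totient (p ^ h) := by
  obtain ⟨g, -, hfg⟩ := exists_conductor_eq hp hf
  rw [(hfg t n).1, (hfg t n).2, card_exactRoots_two_mul hp h1 hv]

theorem exactRoots_conductor_eq_empty_of_lt (hp : p.Prime) (hf : f ≠ 0) (hpf : p ∣ f) {m : ℕ}
    (hm : m < 2 * padicValNat p f) (hne : ∀ h, 1 ≤ h → h < padicValNat p f → m ≠ 2 * h)
    (t n : ℤ) : exactRoots p (f * t) (f ^ 2 * n) m m = ∅ := by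
  obtain ⟨h, rfl | rfl⟩ := m.even_or_odd'
  · obtain rfl : h = 0 := by
      by_contra h0
      exact hne h (by omega) (by omega) rfl
    exact exactRoots_zero_zero
      (((Int.natCast_dvd_natCast.mpr hpf).trans (dvd_pow_self _ two_ne_zero)).mul_right n)
  · obtain ⟨g, -, hfg⟩ := exists_conductor_eq hp hf
    rw [(hfg t n).1, (hfg t n).2]
    exact exactRoots_two_mul_add_one_eq_empty hp (by omega) _ _

end Conductor

/-! ### Ideals of quadratic rings in standard form -/

/-- `1, θ` is a `ℤ`-basis of `R`, and `θ² = T θ - N`: the ring `R` is `ℤ[θ]`, where `θ` has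
trace `T` and norm `N`. -/
structure IsQuadBasis {R : Type*} [CommRing R] (θ : R) (T N : ℤ) : Prop where
  exists_eq : ∀ z : R, ∃ a b : ℤ, z = a + b * θ
  indep : ∀ a b : ℤ, (a : R) + b * θ = 0 → a = 0 ∧ b = 0
  sq : θ ^ 2 = T * θ - N

/-- The ideal `q` is `c (aℤ + (x + θ)ℤ)`. -/
def IsStandardForm {R : Type*} [CommRing R] (θ : R) (c a x : ℤ) (q : Ideal R) : Prop :=
  ∀ z, z ∈ q ↔ ∃ s t : ℤ, z = c * (a * s + (x + θ) * t)

theorem exists_nonneg_mem_iff_dvd (I : Ideal ℤ) : ∃ c : ℤ, 0 ≤ c ∧ ∀ b, b ∈ I ↔ c ∣ b := by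
  obtain ⟨c, rfl⟩ := (IsPrincipalIdealRing.principal I).principal
  exact ⟨|c|, abs_nonneg c, fun b => by rw [abs_dvd]; exact Ideal.mem_span_singleton⟩

theorem eq_pow_of_nonneg_of_dvd_pow {p : ℕ} (hp : p.Prime) {c : ℤ} (hc : 0 ≤ c) {k : ℕ}
    (h : c ∣ (p : ℤ) ^ k) : ∃ l, c = (p : ℤ) ^ l := by
  lift c to ℕ using hc
  obtain ⟨l, -, rfl⟩ := (Nat.dvd_prime_pow hp).mp (by exact_mod_cast h)
  exact ⟨l, Nat.cast_pow p l⟩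

section QuadraticRing

variable {R : Type*} [CommRing R] {θ : R} {T N c a x : ℤ} {q : Ideal R}

namespace IsQuadBasis

theorem ext_iff (B : IsQuadBasis θ T N) {u b u' b' : ℤ} :
    (u : R) + b * θ = u' + b' * θ ↔ u = u' ∧ b = b' := by
  refine ⟨fun h => ?_, by rintro ⟨rfl, rfl⟩; rfl⟩
  have := B.indep (u - u') (b - b') (by push_cast; linear_combination h)
  omega

theorem intCast_injective (B : IsQuadBasis θ T N) : Function.Injective (Int.cast : ℤ → R) :=
  fun u u' h => ((B.ext_iff (b := 0) (b' := 0)).mp (by rw [h])).1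

theorem natCast_ne_zero (B : IsQuadBasis θ T N) {p : ℕ} (hp : p.Prime) : (p : R) ≠ 0 := by
  rw [← Int.cast_natCast, ← Int.cast_zero, B.intCast_injective.ne_iff]
  exact_mod_cast hp.ne_zero

theorem add_mul_conj (B : IsQuadBasis θ T N) (x : ℤ) :
    ((x : R) + θ) * (x + T - θ) = (normForm T N x : ℤ) := by
  unfold normForm
  push_cast
  linear_combination -B.sq

theorem add_sq (B : IsQuadBasis θ T N) (x : ℤ) :
    ((x : R) + θ) ^ 2 = (2 * x + T : ℤ) * (x + θ) - (normForm T N x : ℤ) := by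
  rw [← B.add_mul_conj]
  push_cast
  ring

theorem add_intCast (B : IsQuadBasis θ T N) (s : ℤ) :
    IsQuadBasis (s + θ) (2 * s + T) (normForm T N s) where
  exists_eq z := by
    obtain ⟨u, b, rfl⟩ := B.exists_eq z
    exact ⟨u - b * s, b, by push_cast; ring⟩
  indep u b h := by
    obtain ⟨h1, rfl⟩ := B.indep (u + b * s) b (by push_cast; linear_combination h)
    exact ⟨by simpa using h1, rfl⟩
  sq := B.add_sq s

/-- The `ℤ`-basis `1, θ` of a ring. -/
noncomputable def basis (B : IsQuadBasis θ T N) : Module.Basis (Fin 2) ℤ R :=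
  Module.Basis.mk (v := ![1, θ])
    (LinearIndependent.pair_iff.mpr fun u b h => B.indep u b (by simpa using h))
    (fun z _ => by
      obtain ⟨u, b, rfl⟩ := B.exists_eq z
      rw [Matrix.range_cons_cons_empty]
      exact Submodule.mem_span_pair.mpr ⟨u, b, by simp only [zsmul_eq_mul, mul_one]⟩)

theorem basis_repr (B : IsQuadBasis θ T N) (u b : ℤ) :
    ⇑(B.basis.repr (u + b * θ)) = ![u, b] := by
  have e : (u : R) + b * θ = ∑ i, ![u, b] i • B.basis i := by simp [basis]
  rw [e, Module.Basis.repr_sum_self]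

theorem exists_isStandardForm_of_dvd (B : IsQuadBasis θ T N) (c : ℤ) (h : a ∣ normForm T N x) :
    ∃ q : Ideal R, IsStandardForm θ c a x q := by
  obtain ⟨n, hn⟩ := h
  have hsq := B.add_sq x
  rw [hn] at hsq
  push_cast at hsq
  refine ⟨{ carrier := {z | ∃ s t : ℤ, z = c * (a * s + (x + θ) * t)}
            zero_mem' := ⟨0, 0, by simp⟩
            add_mem' := ?_
            smul_mem' := ?_ }, fun z => Iff.rfl⟩
  · rintro _ _ ⟨s, t, rfl⟩ ⟨s', t', rfl⟩
    exact ⟨s + s', t + t', by push_cast; ring⟩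
  · rintro y _ ⟨s, t, rfl⟩
    obtain ⟨u, b, rfl⟩ := B.exists_eq y
    refine ⟨(u - b * x) * s - b * n * t, (u - b * x) * t + b * a * s + b * (2 * x + T) * t, ?_⟩
    rw [smul_eq_mul]
    push_cast
    linear_combination (c * b * t : R) * hsq

/-- With `c` a generator of the ideal of all coefficients of `θ` in elements of `q`, and `c a` a
generator of `q ∩ ℤ`, there is `q = c (aℤ + (x + θ)ℤ)`. -/
theorem exists_isStandardForm (B : IsQuadBasis θ T N) (q : Ideal R) :
    ∃ c a x : ℤ, 0 ≤ c ∧ 0 ≤ a ∧ IsStandardForm θ c a x q := by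
  obtain ⟨c, hc, hcoeff⟩ :=
    exists_nonneg_mem_iff_dvd ((q.restrictScalars ℤ).map (B.basis.coord 1))
  have hcoord : ∀ b, c ∣ b ↔ ∃ u : ℤ, (u : R) + b * θ ∈ q := fun b => by
    rw [← hcoeff, Submodule.mem_map]
    constructor
    · rintro ⟨z, hz, rfl⟩
      obtain ⟨u, b, rfl⟩ := B.exists_eq z
      exact ⟨u, by rwa [Module.Basis.coord_apply, B.basis_repr]⟩
    · rintro ⟨u, hu⟩
      exact ⟨_, hu, by rw [Module.Basis.coord_apply, B.basis_repr]; rfl⟩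
  obtain ⟨n, hn, hint⟩ := exists_nonneg_mem_iff_dvd (q.comap (Int.castRingHom R))
  simp only [Ideal.mem_comap, eq_intCast] at hint
  obtain ⟨a, ha, rfl⟩ : ∃ a, 0 ≤ a ∧ n = c * a := by
    obtain ⟨a, ha⟩ := (hcoord n).mpr
      ⟨0, by simpa using q.mul_mem_right θ ((hint n).mpr dvd_rfl)⟩
    exact ⟨|a|, abs_nonneg a, by rw [← abs_of_nonneg hn, ha, abs_mul, abs_of_nonneg hc]⟩
  obtain ⟨u₀, hu₀⟩ := (hcoord c).mp dvd_rfl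
  obtain ⟨x, rfl⟩ : c ∣ u₀ := by
    have h : ((-(c * N) : ℤ) : R) + (u₀ + c * T : ℤ) * θ ∈ q := by
      convert q.mul_mem_right θ hu₀ using 1
      push_cast
      linear_combination -(c : R) * B.sq
    exact (dvd_add_left (dvd_mul_right c T)).mp ((hcoord _).mpr ⟨_, h⟩)
  refine ⟨c, a, x, hc, ha, fun z => ⟨fun hz => ?_, ?_⟩⟩
  · obtain ⟨u, b, rfl⟩ := B.exists_eq z
    obtain ⟨t, rfl⟩ := (hcoord b).mpr ⟨u, hz⟩
    obtain ⟨s, hs⟩ : c * a ∣ u - c * x * t := (hint _).mp (by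
      convert q.sub_mem hz (q.mul_mem_right (t : R) hu₀) using 1
      push_cast
      ring)
    obtain rfl := eq_add_of_sub_eq hs
    exact ⟨s, t, by push_cast; ring⟩
  · rintro ⟨s, t, rfl⟩
    convert q.add_mem (q.mul_mem_right (s : R) ((hint _).mpr dvd_rfl))
      (q.mul_mem_right (t : R) hu₀) using 1
    push_cast
    ring

end IsQuadBasis

namespace IsStandardForm

theorem eq {q' : Ideal R} (h : IsStandardForm θ c a x q) (h' : IsStandardForm θ c a x q') :
    q = q' :=
  Ideal.ext fun z => (h z).trans (h' z).symm

theorem intCast_mul_mem (h : IsStandardForm θ c a x q) : ((c * a : ℤ) : R) ∈ q :=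
  (h _).mpr ⟨1, 0, by push_cast; ring⟩

theorem mul_add_mem (h : IsStandardForm θ c a x q) : (c : R) * (x + θ) ∈ q :=
  (h _).mpr ⟨0, 1, by push_cast; ring⟩

theorem add_mem_iff (h : IsStandardForm θ c a x q) (B : IsQuadBasis θ T N) {u b : ℤ} :
    (u : R) + b * θ ∈ q ↔ ∃ s t : ℤ, u = c * (a * s + x * t) ∧ b = c * t := by
  rw [h]
  refine exists₂_congr fun s t => ?_
  rw [← B.ext_iff]
  refine Eq.congr_right ?_
  push_cast
  ring

theorem intCast_mem_iff (h : IsStandardForm θ c a x q) (B : IsQuadBasis θ T N) {u : ℤ} :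
    (u : R) ∈ q ↔ c * a ∣ u := by
  constructor
  · intro hu
    obtain ⟨s, t, hs, ht⟩ := (h.add_mem_iff B (u := u) (b := 0)).mp (by simpa using hu)
    exact ⟨s, by linear_combination hs - x * ht⟩
  · rintro ⟨s, rfl⟩
    rw [Int.cast_mul]
    exact q.mul_mem_right _ h.intCast_mul_mem

theorem dvd_normForm (h : IsStandardForm θ c a x q) (B : IsQuadBasis θ T N) (hc : c ≠ 0) :
    a ∣ normForm T N x := by
  rw [← mul_dvd_mul_iff_left hc, ← h.intCast_mem_iff B, Int.cast_mul, ← B.add_mul_conj, ← mul_assoc]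
  exact q.mul_mem_right _ h.mul_add_mem

theorem congr {y : ℤ} (h : IsStandardForm θ c a x q) (hy : a ∣ y - x) :
    IsStandardForm θ c a y q := by
  obtain ⟨k, hk⟩ := hy
  obtain rfl := eq_add_of_sub_eq hk
  intro z
  rw [h]
  constructor
  · rintro ⟨s, t, rfl⟩
    exact ⟨s - k * t, t, by push_cast; ring⟩
  · rintro ⟨s, t, rfl⟩
    exact ⟨s + k * t, t, by push_cast; ring⟩

theorem dvd_sub {y : ℤ} (h : IsStandardForm θ c a x q) (h' : IsStandardForm θ c a y q)
    (B : IsQuadBasis θ T N) (hc : c ≠ 0) : a ∣ y - x := by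
  rw [← mul_dvd_mul_iff_left hc, ← h.intCast_mem_iff B]
  convert q.sub_mem h'.mul_add_mem h.mul_add_mem using 1
  push_cast
  ring

theorem span_mul (h : IsStandardForm θ c a x q) (d : ℤ) :
    IsStandardForm θ (d * c) a x (Ideal.span {(d : R)} * q) := by
  intro z
  simp only [Ideal.mem_span_singleton_mul, h _]
  constructor
  · rintro ⟨_, ⟨s, t, rfl⟩, rfl⟩
    exact ⟨s, t, by push_cast; ring⟩
  · rintro ⟨s, t, rfl⟩
    exact ⟨_, ⟨s, t, rfl⟩, by push_cast; ring⟩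

theorem top (B : IsQuadBasis θ T N) (x : ℤ) : IsStandardForm θ 1 1 x (⊤ : Ideal R) := fun z => by
  obtain ⟨u, b, rfl⟩ := B.exists_eq z
  exact iff_of_true trivial ⟨u - x * b, b, by push_cast; ring⟩

theorem span_singleton (B : IsQuadBasis θ T N) (c x : ℤ) :
    IsStandardForm θ c 1 x (Ideal.span {(c : R)}) := by
  simpa only [mul_one, Ideal.mul_top] using (top B x).span_mul c

theorem eq_span_pair (h : IsStandardForm θ 1 a x q) :
    q = Ideal.span {(a : R), x + θ} := by
  refine le_antisymm (fun z hz => ?_) (Ideal.span_le.mpr ?_)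
  · obtain ⟨s, t, rfl⟩ := (h z).mp hz
    exact Ideal.mem_span_pair.mpr ⟨s, t, by push_cast; ring⟩
  · rintro z (rfl | rfl)
    · simpa using h.intCast_mul_mem
    · simpa using h.mul_add_mem

theorem ne_top_iff (h : IsStandardForm θ c a x q) (B : IsQuadBasis θ T N) :
    q ≠ ⊤ ↔ ¬ IsUnit (c * a) := by
  rw [Ideal.ne_top_iff_one, ← Int.cast_one, h.intCast_mem_iff B, isUnit_iff_dvd_one]

theorem ne_bot (h : IsStandardForm θ c a x q) (B : IsQuadBasis θ T N) (hca : c * a ≠ 0) :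
    q ≠ ⊥ := by
  rintro rfl
  exact hca (B.intCast_injective (h.intCast_mul_mem.trans Int.cast_zero.symm))

theorem idealNorm_eq (h : IsStandardForm θ c a x q) (B : IsQuadBasis θ T N) (hca : c * a ≠ 0) :
    idealNorm q = (c ^ 2 * a).natAbs := by
  have hc := left_ne_zero_of_mul hca
  set v : Fin 2 → R := ![(c * a : ℤ) + (0 : ℤ) * θ, (c * x : ℤ) + (c : ℤ) * θ] with hv
  have hindep : LinearIndependent ℤ v := by
    refine LinearIndependent.pair_iff.mpr fun s t hst => ?_
    obtain ⟨h1, h2⟩ := B.indep (s * (c * a) + t * (c * x)) (t * c) (by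
      rw [← hst]
      push_cast
      simp only [zsmul_eq_mul]
      ring)
    obtain rfl := (mul_eq_zero_iff_right hc).mp h2
    exact ⟨(mul_eq_zero_iff_right hca).mp (by simpa using h1), rfl⟩
  have hspan : q.restrictScalars ℤ = Submodule.span ℤ (Set.range v) := by
    ext z
    rw [Submodule.restrictScalars_mem, h, hv, Matrix.range_cons_cons_empty, Submodule.mem_span_pair]
    refine exists₂_congr fun s t => ?_
    rw [eq_comm]
    refine Eq.congr_left ?_
    push_cast
    simp only [zsmul_eq_mul]
    ring
  have : Module.Free ℤ R := .of_basis B.basis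
  have : Module.Finite ℤ R := .of_basis B.basis
  have hcard := Submodule.natAbs_det_basis_change B.basis _ (Module.Basis.span hindep)
  have hdet : B.basis.det ((↑) ∘ Module.Basis.span hindep) = c ^ 2 * a := by
    have e : ((↑) ∘ Module.Basis.span hindep : Fin 2 → R) = v :=
      funext fun i => congrArg Subtype.val (Module.Basis.span_apply hindep i)
    rw [e, Module.Basis.det_apply, Matrix.det_fin_two]
    simp only [Module.Basis.toMatrix_apply, hv, Matrix.cons_val_zero, Matrix.cons_val_one,
      B.basis_repr]
    ring
  rw [hdet, ← hspan] at hcard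
  exact hcard.symm

end IsStandardForm

theorem IsQuadBasis.dvd_of_add_mem_span (B : IsQuadBasis θ T N) {u b : ℤ}
    (h : (u : R) + b * θ ∈ Ideal.span {(c : R)}) : c ∣ b := by
  obtain ⟨s, t, -, ht⟩ := ((IsStandardForm.span_singleton B c 0).add_mem_iff B).mp h
  exact ⟨t, ht⟩

theorem IsQuadBasis.exists_isStandardForm_pow (B : IsQuadBasis θ T N) {p : ℕ} (hp : p.Prime)
    {k : ℕ} (hk : (p : R) ^ k ∈ q) :
    ∃ (l m : ℕ) (x : ℤ), 0 ≤ x ∧ x < (p : ℤ) ^ m ∧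
      IsStandardForm θ ((p : ℤ) ^ l) ((p : ℤ) ^ m) x q := by
  obtain ⟨c, a, x, hc, ha, h⟩ := B.exists_isStandardForm q
  have hdvd : c * a ∣ (p : ℤ) ^ k := (h.intCast_mem_iff B).mp (by push_cast; exact hk)
  obtain ⟨l, rfl⟩ := eq_pow_of_nonneg_of_dvd_pow hp hc (dvd_of_mul_right_dvd hdvd)
  obtain ⟨m, rfl⟩ := eq_pow_of_nonneg_of_dvd_pow hp ha (dvd_of_mul_left_dvd hdvd)
  have hpm : (0 : ℤ) < (p : ℤ) ^ m := pow_pos (by exact_mod_cast hp.pos) m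
  exact ⟨l, m, x % (p : ℤ) ^ m, Int.emod_nonneg x hpm.ne', Int.emod_lt_of_pos x hpm,
    h.congr (Int.mod_modEq x _).symm.dvd⟩

theorem IsStandardForm.mul_conj_eq {n : ℤ} {q' : Ideal R} (h : IsStandardForm θ 1 a x q)
    (h' : IsStandardForm θ 1 a (-x - T) q') (B : IsQuadBasis θ T N)
    (hn : normForm T N x = a * n) (hgcd : Int.gcd a (Int.gcd (2 * x + T) n) = 1) :
    q * q' = Ideal.span {(a : R)} := by
  have hmul : ((x : R) + θ) * ((-x - T : ℤ) + θ) = -(a * n) := by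
    rw [← Int.cast_mul, ← hn, ← B.add_mul_conj]
    push_cast
    ring
  obtain ⟨u, w, huw⟩ := Int.isCoprime_iff_gcd_eq_one.mpr hgcd
  rw [Int.gcd_eq_gcd_ab (2 * x + T) n] at huw
  rw [h.eq_span_pair, h'.eq_span_pair, Ideal.span_pair_mul_span_pair]
  refine le_antisymm (Ideal.span_le.mpr ?_) ((Ideal.span_singleton_le_iff_mem _).mpr ?_)
  · rintro z (rfl | rfl | rfl | rfl) <;> rw [SetLike.mem_coe, Ideal.mem_span_singleton]
    · exact dvd_mul_right _ _
    · exact dvd_mul_right _ _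
    · exact dvd_mul_left _ _
    · exact hmul ▸ (dvd_mul_right _ _).neg_right
  · set I := Ideal.span {(a : R) * a, (a : R) * ((-x - T : ℤ) + θ), (x + θ) * a,
      (x + θ) * ((-x - T : ℤ) + θ)}
    have hsq : ((a * a : ℤ) : R) ∈ I := Ideal.subset_span (by simp)
    have htr : ((a * (2 * x + T) : ℤ) : R) ∈ I := by
      have e : ((a * (2 * x + T) : ℤ) : R) = (x + θ) * a - a * ((-x - T : ℤ) + θ) := by
        push_cast
        ring
      exact e ▸ I.sub_mem (Ideal.subset_span (by simp)) (Ideal.subset_span (by simp))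
    have hnm : ((a * n : ℤ) : R) ∈ I := by
      rw [Int.cast_mul, ← neg_mem_iff, ← hmul]
      exact Ideal.subset_span (by simp)
    have e : a = u * (a * a) + (w * (2 * x + T).gcdA n * (a * (2 * x + T)) +
        w * (2 * x + T).gcdB n * (a * n)) := by linear_combination -a * huw
    rw [e, Int.cast_add, Int.cast_add, Int.cast_mul, Int.cast_mul (_ * _), Int.cast_mul (_ * _)]
    exact I.add_mem (I.mul_mem_left _ hsq) (I.add_mem (I.mul_mem_left _ htr) (I.mul_mem_left _ hnm))

/-! ### Invertible ideals -/

section Invertible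

variable [IsDomain R]

theorem invertible_of_mul_eq_span {I J : Ideal R} {y : R} (hy : y ≠ 0)
    (h : I * J = Ideal.span {y}) : Invertible I := by
  have hprod : (I : FractionalIdeal R⁰ (FractionRing R)) * J =
      FractionalIdeal.spanSingleton R⁰ (algebraMap R (FractionRing R) y) := by
    rw [← FractionalIdeal.coeIdeal_mul, h, FractionalIdeal.coeIdeal_span_singleton]
  have hy' : algebraMap R (FractionRing R) y ≠ 0 := by simpa using hy
  refine isUnit_of_mul_isUnit_left (y := (J : FractionalIdeal R⁰ (FractionRing R))) ?_
  rw [hprod]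
  refine IsUnit.of_mul_eq_one
    (FractionalIdeal.spanSingleton R⁰ (algebraMap R (FractionRing R) y)⁻¹) ?_
  rw [FractionalIdeal.spanSingleton_mul_spanSingleton, mul_inv_cancel₀ hy',
    FractionalIdeal.spanSingleton_one]

theorem Invertible.le_of_mul_le_mul {I J J' : Ideal R} (h : Invertible I)
    (hle : J * I ≤ J' * I) : J ≤ J' := by
  obtain ⟨u, hu⟩ := h
  rw [← FractionalIdeal.coeIdeal_le_coeIdeal (FractionRing R), FractionalIdeal.coeIdeal_mul,
    FractionalIdeal.coeIdeal_mul, ← hu] at hle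
  rw [← FractionalIdeal.coeIdeal_le_coeIdeal (FractionRing R)]
  simpa [mul_assoc] using mul_le_mul_left hle (u⁻¹ : (FractionalIdeal R⁰ (FractionRing R))ˣ).val

theorem IsStandardForm.isUnit_of_dvd {d n : ℤ} (h : IsStandardForm θ c a x q)
    (B : IsQuadBasis θ T N) (hn : normForm T N x = a * n) (hq : Invertible q) (hda : d ∣ a)
    (hdT : d ∣ 2 * x + T) (hdn : d ∣ n) : IsUnit d := by
  obtain ⟨a', rfl⟩ := hda
  obtain ⟨n', rfl⟩ := hdn
  obtain ⟨T', hT'⟩ := hdT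
  have hsq := B.add_sq x
  rw [hn, hT'] at hsq
  push_cast at hsq
  have hle : Ideal.span {(x : R) + θ} ≤ Ideal.span {(d : R)} := by
    refine hq.le_of_mul_le_mul (Ideal.span_singleton_mul_le_iff.mpr fun z hz => ?_)
    obtain ⟨s, t, rfl⟩ := (h z).mp hz
    refine Ideal.mem_span_singleton_mul.mpr
      ⟨_, (h _).mpr ⟨-(n' * t), a' * s + T' * t, rfl⟩, ?_⟩
    push_cast
    linear_combination -(c * t : R) * hsq
  exact isUnit_of_dvd_one (B.dvd_of_add_mem_span (u := x)
    (by simpa using hle (Ideal.mem_span_singleton_self _)))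

theorem IsStandardForm.invertible_iff {n : ℤ} (h : IsStandardForm θ c a x q)
    (B : IsQuadBasis θ T N) (hca : c * a ≠ 0) (hn : normForm T N x = a * n) :
    Invertible q ↔ Int.gcd a (Int.gcd (2 * x + T) n) = 1 := by
  constructor
  · intro hq
    have hunit := h.isUnit_of_dvd B hn hq (Int.gcd_dvd_left a (Int.gcd (2 * x + T) n))
      ((Int.gcd_dvd_right a _).trans (Int.gcd_dvd_left (2 * x + T) n))
      ((Int.gcd_dvd_right a _).trans (Int.gcd_dvd_right (2 * x + T) n))
    rwa [Int.ofNat_isUnit, Nat.isUnit_iff] at hunit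
  · intro hgcd
    obtain ⟨q₁, h₁⟩ := B.exists_isStandardForm_of_dvd 1 (Dvd.intro n hn.symm)
    obtain ⟨q₂, h₂⟩ := B.exists_isStandardForm_of_dvd 1
      (Dvd.intro n ((normForm_neg_sub T N x).trans hn).symm)
    have hq : q = Ideal.span {(c : R)} * q₁ := h.eq (by simpa only [mul_one] using h₁.span_mul c)
    refine invertible_of_mul_eq_span (J := q₂) (y := ((c * a : ℤ) : R))
      (fun h0 => hca (B.intCast_injective (h0.trans Int.cast_zero.symm))) ?_
    rw [hq, mul_assoc, h₁.mul_conj_eq h₂ B hn hgcd, Ideal.span_singleton_mul_span_singleton,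
      Int.cast_mul]

end Invertible

end QuadraticRing

/-! ### Singular primes -/

/-- `P = pℤ + (s + θ)ℤ`, where `s` is a double root of `X² + T X + N` modulo `p` and a root
modulo `p²`. For an order of conductor `f` and a prime `p` dividing `f`, this is the only prime
ideal containing `p`, and it is not invertible. -/
structure IsSingularPrime {R : Type*} [CommRing R] (θ : R) (T N : ℤ) (p : ℕ) (s : ℤ)
    (P : Ideal R) : Prop where
  prime : p.Prime
  isQuadBasis : IsQuadBasis θ T N
  isStandardForm : IsStandardForm θ 1 p s P
  dvd_deriv : (p : ℤ) ∣ 2 * s + T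
  sq_dvd_normForm : (p : ℤ) ^ 2 ∣ normForm T N s

section QuadraticRing

variable {R : Type*} [CommRing R] {θ : R} {T N s x : ℤ} {p m l : ℕ} {q P : Ideal R}

theorem IsStandardForm.isMaximal (h : IsStandardForm θ 1 p s P) (B : IsQuadBasis θ T N)
    (hp : p.Prime) : P.IsMaximal := by
  have hpp : Prime (p : ℤ) := Nat.prime_iff_prime_int.mp hp
  refine Ideal.isMaximal_iff.mpr ⟨(Ideal.ne_top_iff_one P).mp ((h.ne_top_iff B).mpr ?_), ?_⟩
  · simpa only [one_mul] using hpp.not_isUnit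
  intro J z hPJ hz hzJ
  obtain ⟨u, b, rfl⟩ := B.exists_eq z
  have hndvd : ¬ (p : ℤ) ∣ u - s * b := by
    rintro ⟨k, hk⟩
    exact hz ((h.add_mem_iff B).mpr ⟨k, b, by linear_combination hk, (one_mul b).symm⟩)
  obtain ⟨i, j, hij⟩ := (Prime.coprime_iff_not_dvd hpp).mpr hndvd
  have hij' : (i : R) * p + j * (u - s * b) = 1 := by
    exact_mod_cast congrArg (Int.cast (R := R)) hij
  have hpJ : (p : R) ∈ J := hPJ (by simpa using h.intCast_mul_mem)
  have hsJ : (s : R) + θ ∈ J := hPJ (by simpa using h.mul_add_mem)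
  rw [← hij']
  convert J.add_mem (J.mul_mem_left (i : R) hpJ)
    (J.sub_mem (J.mul_mem_left (j : R) hzJ) (J.mul_mem_left (j * b : R) hsJ)) using 1
  ring

theorem IsQuadBasis.exists_isSingularPrime (B : IsQuadBasis θ T N) (hp : p.Prime)
    (hT : (p : ℤ) ∣ T) (hN : (p : ℤ) ^ 2 ∣ N) (c : ℤ) :
    ∃ P, IsSingularPrime (c + θ) (2 * c + T) (normForm T N c) p (-c) P := by
  have hderiv : 2 * -c + (2 * c + T) = T := by ring
  have hnorm : normForm (2 * c + T) (normForm T N c) (-c) = N := by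
    unfold normForm
    ring
  obtain ⟨P, hP⟩ := (B.add_intCast c).exists_isStandardForm_of_dvd (a := p) (x := -c) 1
    (by rw [hnorm]; exact (dvd_pow_self _ two_ne_zero).trans hN)
  exact ⟨P, hp, B.add_intCast c, hP, by rwa [hderiv], by rwa [hnorm]⟩

namespace IsSingularPrime

theorem pow_ne_zero (h : IsSingularPrime θ T N p s P) (k : ℕ) : (p : ℤ) ^ k ≠ 0 :=
  _root_.pow_ne_zero k (by exact_mod_cast h.prime.ne_zero)

theorem mul_pow_ne_zero (h : IsSingularPrime θ T N p s P) (l m : ℕ) :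
    (p : ℤ) ^ l * (p : ℤ) ^ m ≠ 0 :=
  mul_ne_zero (h.pow_ne_zero l) (h.pow_ne_zero m)

theorem isMaximal (h : IsSingularPrime θ T N p s P) : P.IsMaximal :=
  h.isStandardForm.isMaximal h.isQuadBasis h.prime

theorem ne_top_iff (h : IsSingularPrime θ T N p s P)
    (hq : IsStandardForm θ ((p : ℤ) ^ l) ((p : ℤ) ^ m) x q) : q ≠ ⊤ ↔ 1 ≤ l + m := by
  rw [hq.ne_top_iff h.isQuadBasis, ← pow_add, Nat.one_le_iff_ne_zero,
    isUnit_pow_iff_of_not_isUnit (Nat.prime_iff_prime_int.mp h.prime).not_isUnit]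

theorem dvd_deriv_of_dvd_normForm (h : IsSingularPrime θ T N p s P)
    (hx : (p : ℤ) ∣ normForm T N x) : (p : ℤ) ∣ 2 * x + T := by
  have hxs : (p : ℤ) ∣ x - s := (dvd_normForm_iff_of_double_root h.prime
    ((dvd_pow_self _ two_ne_zero).trans h.sq_dvd_normForm) h.dvd_deriv x).mp hx
  have e : 2 * x + T = 2 * (x - s) + (2 * s + T) := by ring
  exact e ▸ (hxs.mul_left 2).add h.dvd_deriv

theorem mul_self_le (h : IsSingularPrime θ T N p s P) : P * P ≤ Ideal.span {(p : R)} * P := by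
  obtain ⟨t, ht⟩ := h.dvd_deriv
  obtain ⟨n, hn⟩ := h.sq_dvd_normForm
  have hsq := h.isQuadBasis.add_sq s
  rw [ht, hn] at hsq
  push_cast at hsq
  have hp : (p : R) ∈ P := by simpa using h.isStandardForm.intCast_mul_mem
  have hs : (s : R) + θ ∈ P := by simpa using h.isStandardForm.mul_add_mem
  rw [h.isStandardForm.eq_span_pair, Ideal.span_pair_mul_span_pair,
    ← h.isStandardForm.eq_span_pair, Ideal.span_le]
  rintro z (rfl | rfl | rfl | rfl) <;> rw [SetLike.mem_coe, Ideal.mem_span_singleton_mul]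
  · exact ⟨p, hp, by push_cast; ring⟩
  · exact ⟨s + θ, hs, by push_cast; ring⟩
  · exact ⟨s + θ, hs, by push_cast; ring⟩
  · exact ⟨t * (s + θ) - n * p, P.sub_mem (P.mul_mem_left _ hs) (P.mul_mem_left _ hp),
      by linear_combination -hsq⟩

theorem radical_eq_iff (h : IsSingularPrime θ T N p s P) :
    q.radical = P ↔ (∃ k : ℕ, (p : R) ^ k ∈ q) ∧ q ≠ ⊤ := by
  have hp : (p : R) ∈ P := by simpa using h.isStandardForm.intCast_mul_mem
  constructor
  · rintro rfl
    exact ⟨hp, fun hq => h.isMaximal.ne_top (by rw [hq, Ideal.radical_top])⟩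
  · rintro ⟨hk, hq⟩
    have hpq : (p : R) ∈ q.radical := hk
    have hle : Ideal.span {(p : R)} ≤ q.radical := (Ideal.span_singleton_le_iff_mem _).mpr hpq
    refine (h.isMaximal.eq_of_le (fun ht => hq (Ideal.radical_eq_top.mp ht)) fun z hz => ?_).symm
    have hzz : z ^ 2 ∈ P * P := pow_two z ▸ Ideal.mul_mem_mul hz hz
    rw [← Ideal.radical_idem]
    exact ⟨2, hle (Ideal.mul_le_left (h.mul_self_le hzz))⟩

theorem radical_eq_iff_one_le (h : IsSingularPrime θ T N p s P)
    (hq : IsStandardForm θ ((p : ℤ) ^ l) ((p : ℤ) ^ m) x q) : q.radical = P ↔ 1 ≤ l + m := by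
  rw [h.radical_eq_iff, h.ne_top_iff hq]
  exact and_iff_right ⟨l + m, by simpa [pow_add] using hq.intCast_mul_mem⟩

theorem radical_eq_iff_exists (h : IsSingularPrime θ T N p s P) :
    q.radical = P ↔ ∃ (l m : ℕ) (x : ℤ), 1 ≤ l + m ∧ 0 ≤ x ∧ x < (p : ℤ) ^ m ∧
      (p : ℤ) ^ m ∣ normForm T N x ∧ IsStandardForm θ ((p : ℤ) ^ l) ((p : ℤ) ^ m) x q := by
  constructor
  · intro hrad
    obtain ⟨⟨k, hk⟩, -⟩ := h.radical_eq_iff.mp hrad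
    obtain ⟨l, m, x, hx0, hx, hform⟩ := h.isQuadBasis.exists_isStandardForm_pow h.prime hk
    exact ⟨l, m, x, (h.radical_eq_iff_one_le hform).mp hrad, hx0, hx,
      hform.dvd_normForm h.isQuadBasis (h.pow_ne_zero l), hform⟩
  · rintro ⟨l, m, x, hlm, -, -, -, hform⟩
    exact (h.radical_eq_iff_one_le hform).mpr hlm

theorem isPrimary_of_radical_eq (h : IsSingularPrime θ T N p s P) (hq : q.radical = P) :
    q.IsPrimary :=
  Ideal.isPrimary_of_isMaximal_radical (hq ▸ h.isMaximal)

theorem idealNorm_eq (h : IsSingularPrime θ T N p s P)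
    (hq : IsStandardForm θ ((p : ℤ) ^ l) ((p : ℤ) ^ m) x q) : idealNorm q = p ^ (2 * l + m) := by
  rw [hq.idealNorm_eq h.isQuadBasis (h.mul_pow_ne_zero l m), ← pow_mul, ← pow_add, Int.natAbs_pow,
    Int.natAbs_natCast, mul_comm l]

section Domain

variable [IsDomain R]

theorem invertible_iff (h : IsSingularPrime θ T N p s P)
    (hq : IsStandardForm θ ((p : ℤ) ^ l) ((p : ℤ) ^ m) x q) :
    Invertible q ↔ m = 0 ∨ ¬ (p : ℤ) ^ (m + 1) ∣ normForm T N x := by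
  obtain ⟨n, hn⟩ := hq.dvd_normForm h.isQuadBasis (h.pow_ne_zero l)
  rw [hq.invertible_iff h.isQuadBasis (h.mul_pow_ne_zero l m) hn, hn, pow_succ,
    mul_dvd_mul_iff_left (h.pow_ne_zero m)]
  rcases m with _ | m
  · simp
  have hderiv : (p : ℤ) ∣ 2 * x + T := h.dvd_deriv_of_dvd_normForm
    (hn ▸ (dvd_pow_self _ m.succ_ne_zero).mul_right n)
  rw [or_iff_right m.succ_ne_zero]
  constructor
  · intro hgcd hpn
    refine h.prime.one_lt.ne' (Nat.dvd_one.mp (hgcd ▸ ?_))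
    exact_mod_cast Int.dvd_coe_gcd (dvd_pow_self _ m.succ_ne_zero) (Int.dvd_coe_gcd hderiv hpn)
  · intro hpn
    have hcop : IsCoprime ((p : ℤ) ^ (m + 1)) n :=
      ((Prime.coprime_iff_not_dvd (Nat.prime_iff_prime_int.mp h.prime)).mpr hpn).pow_left
    rw [← Int.isCoprime_iff_gcd_eq_one]
    exact hcop.of_isCoprime_of_dvd_right (Int.gcd_dvd_right _ _)

theorem isIdealAtom_of_not_le (h : IsSingularPrime θ T N p s P) (hrad : q.radical = P)
    (hbot : q ≠ ⊥) (hq : ¬ q ≤ P * P) : IsIdealAtom q := by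
  obtain ⟨⟨k, hk⟩, htop⟩ := h.radical_eq_iff.mp hrad
  refine ⟨hbot, mt Ideal.isUnit_iff.mp htop, ?_⟩
  rintro I J rfl
  rw [Ideal.isUnit_iff, Ideal.isUnit_iff]
  by_contra! hIJ
  have hle : ∀ {J' : Ideal R}, I * J ≤ J' → J' ≠ ⊤ → J' ≤ P := fun hJ' hne =>
    h.radical_eq_iff.mpr ⟨⟨k, hJ' hk⟩, hne⟩ ▸ Ideal.le_radical
  exact hq (Ideal.mul_mono (hle Ideal.mul_le_left hIJ.1) (hle Ideal.mul_le_right hIJ.2))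

theorem isIdealAtom (h : IsSingularPrime θ T N p s P) (hrad : q.radical = P)
    (hq : IsStandardForm θ 1 ((p : ℤ) ^ m) x q) : IsIdealAtom q := by
  refine h.isIdealAtom_of_not_le hrad
    (hq.ne_bot h.isQuadBasis (by simpa only [one_mul] using h.pow_ne_zero m)) fun hle => ?_
  have hmem : (x : R) + θ ∈ Ideal.span {((p : ℤ) : R)} := by
    simpa using Ideal.mul_le_left (h.mul_self_le (hle hq.mul_add_mem))
  exact (Nat.prime_iff_prime_int.mp h.prime).not_dvd_one
    (h.isQuadBasis.dvd_of_add_mem_span (u := x) (by simpa using hmem))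

theorem isIdealAtom_span (h : IsSingularPrime θ T N p s P) :
    IsIdealAtom (Ideal.span {(p : R)}) := by
  have hp := h.isQuadBasis.natCast_ne_zero h.prime
  have hrad : (Ideal.span {(p : R)}).radical = P := h.radical_eq_iff.mpr
    ⟨⟨1, by simp⟩, fun htop => h.isMaximal.ne_top
      (eq_top_mono ((Ideal.span_singleton_le_iff_mem _).mpr
        (by simpa using h.isStandardForm.intCast_mul_mem)) htop)⟩
  refine h.isIdealAtom_of_not_le hrad (by simpa using hp) fun hle => ?_
  obtain ⟨z, hz, hpz⟩ := Ideal.mem_span_singleton_mul.mp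
    (h.mul_self_le (hle (Ideal.mem_span_singleton_self _)))
  exact (Ideal.ne_top_iff_one P).mp h.isMaximal.ne_top ((mul_eq_left₀ hp).mp hpz ▸ hz)

theorem eq_span_or_eq_zero_of_isIdealAtom (h : IsSingularPrime θ T N p s P)
    (hq : IsStandardForm θ ((p : ℤ) ^ l) ((p : ℤ) ^ m) x q) (hatom : IsIdealAtom q) :
    q = Ideal.span {(p : R)} ∨ l = 0 := by
  rcases l with _ | l
  · exact Or.inr rfl
  obtain ⟨q', hq'⟩ := h.isQuadBasis.exists_isStandardForm_of_dvd ((p : ℤ) ^ l)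
    (hq.dvd_normForm h.isQuadBasis (h.pow_ne_zero _))
  have e : q = Ideal.span {(p : R)} * q' := by
    have := hq'.span_mul p
    rw [← pow_succ', Int.cast_natCast] at this
    exact hq.eq this
  rcases hatom.2.isUnit_or_isUnit e with hu | hu
  · exact absurd hu h.isIdealAtom_span.2.not_isUnit
  · exact Or.inl (by rw [e, Ideal.isUnit_iff.mp hu, Ideal.mul_top])

theorem isIdealAtom_and_invertible_iff (h : IsSingularPrime θ T N p s P)
    (hq : IsStandardForm θ 1 ((p : ℤ) ^ m) x q) :
    IsIdealAtom q ∧ Invertible q ↔ 1 ≤ m ∧ ¬ (p : ℤ) ^ (m + 1) ∣ normForm T N x := by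
  rw [← pow_zero (p : ℤ)] at hq
  rw [h.invertible_iff hq]
  constructor
  · rintro ⟨hatom, hinv⟩
    have hm := (h.ne_top_iff hq).mp (mt Ideal.isUnit_iff.mpr hatom.2.not_isUnit)
    exact ⟨by omega, hinv.resolve_left (by omega)⟩
  · rintro ⟨hm, hx⟩
    exact ⟨h.isIdealAtom ((h.radical_eq_iff_one_le hq).mpr (by omega)) (pow_zero (p : ℤ) ▸ hq),
      Or.inr hx⟩

theorem isIdealAtom_iff (h : IsSingularPrime θ T N p s P) (hrad : q.radical = P) :
    IsIdealAtom q ↔ q = Ideal.span {(p : R)} ∨ ∃ (m : ℕ) (x : ℤ), 1 ≤ m ∧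
      (p : ℤ) ^ m ∣ normForm T N x ∧ IsStandardForm θ 1 ((p : ℤ) ^ m) x q := by
  constructor
  · intro hatom
    obtain ⟨l, m, x, hlm, -, -, hdvd, hq⟩ := h.radical_eq_iff_exists.mp hrad
    refine (h.eq_span_or_eq_zero_of_isIdealAtom hq hatom).imp_right ?_
    rintro rfl
    exact ⟨m, x, by omega, hdvd, by simpa only [pow_zero] using hq⟩
  · rintro (rfl | ⟨m, x, -, -, hq⟩)
    · exact h.isIdealAtom_span
    · exact h.isIdealAtom hrad hq

/-- The exact roots modulo `p ^ m` are counted around the singular point `s`, that is, for the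
polynomial `(s + Y)² + T (s + Y) + N` in `Y`. -/
theorem encard_invertible_atoms (h : IsSingularPrime θ T N p s P) (m : ℕ) :
    {q : Ideal R | IsIdealAtom q ∧ Invertible q ∧ idealNorm q = p ^ m ∧
      ∃ x : ℤ, IsStandardForm θ 1 ((p : ℤ) ^ m) x q}.encard =
      (exactRoots p (2 * s + T) (normForm T N s) m m).card := by
  have hpos : (0 : ℤ) < (p : ℤ) ^ m := pow_pos (by exact_mod_cast h.prime.pos) m
  have hform : ∀ y ∈ exactRoots p (2 * s + T) (normForm T N s) m m,
      ∃ q : Ideal R, IsStandardForm θ 1 ((p : ℤ) ^ m) (s + y) q := fun y hy =>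
    h.isQuadBasis.exists_isStandardForm_of_dvd 1 (normForm_add T N s y ▸ (mem_exactRoots.mp hy).2.1)
  choose! g hg using hform
  have hinj : Set.InjOn g (exactRoots p (2 * s + T) (normForm T N s) m m) := by
    intro y hy y' hy' hyy'
    have hdvd := (hg y hy).dvd_sub (hyy' ▸ hg y' hy') h.isQuadBasis one_ne_zero
    obtain ⟨⟨hy0, hy1⟩, -⟩ := mem_exactRoots.mp hy
    obtain ⟨⟨hy0', hy1'⟩, -⟩ := mem_exactRoots.mp hy'
    rw [add_sub_add_left_eq_sub] at hdvd
    linarith [Int.eq_zero_of_abs_lt_dvd hdvd (by rw [abs_lt]; constructor <;> linarith)]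
  rw [← Set.encard_coe_eq_coe_finsetCard, ← hinj.encard_image]
  congr 1
  ext q
  constructor
  · rintro ⟨hatom, hinv, -, x, hq⟩
    have hq' := hq.congr (y := s + (x - s) % (p : ℤ) ^ m)
      ⟨-((x - s) / (p : ℤ) ^ m), by linear_combination Int.emod_add_mul_ediv (x - s) ((p : ℤ) ^ m)⟩
    have hy : (x - s) % (p : ℤ) ^ m ∈ exactRoots p (2 * s + T) (normForm T N s) m m := by
      rw [mem_exactRoots, ← normForm_add]
      exact ⟨⟨Int.emod_nonneg _ hpos.ne', Int.emod_lt_of_pos _ hpos⟩,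
        hq'.dvd_normForm h.isQuadBasis one_ne_zero,
        ((h.isIdealAtom_and_invertible_iff hq').mp ⟨hatom, hinv⟩).2⟩
    exact ⟨_, hy, (hg _ hy).eq hq'⟩
  · rintro ⟨y, hy, rfl⟩
    have hm : 1 ≤ m := by
      by_contra! hm
      obtain rfl := Nat.lt_one_iff.mp hm
      simp [exactRoots_zero_zero ((dvd_pow_self _ two_ne_zero).trans h.sq_dvd_normForm)] at hy
    obtain ⟨-, -, hexact⟩ := mem_exactRoots.mp hy
    rw [← normForm_add] at hexact
    obtain ⟨hatom, hinv⟩ := (h.isIdealAtom_and_invertible_iff (hg y hy)).mpr ⟨hm, hexact⟩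
    exact ⟨hatom, hinv, by simpa using h.idealNorm_eq (l := 0) (by simpa using hg y hy), _, hg y hy⟩

theorem finite_atoms (h : IsSingularPrime θ T N p s P) {M : ℕ}
    (hM : ∀ y, ¬ (p : ℤ) ^ M ∣ normForm (2 * s + T) (normForm T N s) y) :
    {q : Ideal R | IsIdealAtom q ∧ q.radical = P}.Finite := by
  have hforms : (⋃ (m : Fin M) (x : Set.Ico (0 : ℤ) ((p : ℤ) ^ M)),
      {q : Ideal R | IsStandardForm θ 1 ((p : ℤ) ^ (m : ℕ)) x q}).Finite :=
    Set.finite_iUnion fun m => Set.finite_iUnion fun x =>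
      Set.Subsingleton.finite fun q hq q' hq' => hq.eq hq'
  refine (hforms.insert (Ideal.span {(p : R)})).subset ?_
  rintro q ⟨hatom, hrad⟩
  obtain ⟨l, m, x, -, hx0, hx, hdvd, hq⟩ := h.radical_eq_iff_exists.mp hrad
  refine (h.eq_span_or_eq_zero_of_isIdealAtom hq hatom).imp_right ?_
  rintro rfl
  have hmM : m < M := by
    by_contra! hle
    refine hM (x - s) ((pow_dvd_pow _ hle).trans ?_)
    rwa [← normForm_add, add_sub_cancel]
  have hpow : (p : ℤ) ^ m ≤ (p : ℤ) ^ M :=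
    pow_le_pow_right₀ (by exact_mod_cast h.prime.one_lt.le) hmM.le
  exact Set.mem_iUnion₂.mpr ⟨⟨m, hmM⟩, ⟨x, hx0, hx.trans_le hpow⟩, by simpa using hq⟩

theorem infinite_invertible_atoms (h : IsSingularPrime θ T N p s P) {M : ℕ}
    (hM : ∀ m, M ≤ m → (exactRoots p (2 * s + T) (normForm T N s) m m).Nonempty) :
    {q : Ideal R | IsIdealAtom q ∧ Invertible q ∧ q.radical = P}.Infinite := by
  refine Set.Infinite.of_image idealNorm (Set.infinite_of_forall_exists_gt fun n => ?_)
  have hne := Finset.card_pos.mpr (hM (M + n + 1) (by omega))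
  have hcard := h.encard_invertible_atoms (M + n + 1)
  obtain ⟨q, hatom, hinv, hnorm, x, hq⟩ := Set.encard_pos.mp (hcard ▸ Nat.cast_pos.mpr hne)
  have hrad : q.radical = P :=
    (h.radical_eq_iff_one_le (l := 0) (by simpa using hq)).mpr (by omega)
  refine ⟨idealNorm q, ⟨q, ⟨hatom, hinv, hrad⟩, rfl⟩, ?_⟩
  have := Nat.lt_pow_self (n := M + n + 1) h.prime.one_lt
  omega

end Domain

end IsSingularPrime

end QuadraticRing

/-! ### Decomposition of primes -/

section Decomposition

variable {R : Type*} [CommRing R] {w : R} {t n x : ℤ} {p : ℕ} {P Q : Ideal R}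

theorem IsQuadBasis.not_dvd_normForm_of_isPrime (B : IsQuadBasis w t n) (hp : p.Prime)
    (h : (Ideal.span {(p : R)}).IsPrime) (x : ℤ) : ¬ (p : ℤ) ∣ normForm t n x := by
  intro hx
  have hunit := (Nat.prime_iff_prime_int.mp hp).not_isUnit
  rw [← Int.cast_natCast] at h
  have hmem : ((x : R) + w) * (x + t - w) ∈ Ideal.span {((p : ℤ) : R)} := by
    rw [B.add_mul_conj, Ideal.mem_span_singleton]
    exact map_dvd (Int.castRingHom R) hx
  rcases h.mem_or_mem hmem with h1 | h1
  · exact hunit (isUnit_of_dvd_one (B.dvd_of_add_mem_span (u := x) (by simpa using h1)))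
  · refine hunit (isUnit_of_dvd_one (dvd_neg.mp (B.dvd_of_add_mem_span (u := x + t) ?_)))
    have e : ((x + t : ℤ) : R) + (-1 : ℤ) * w = x + t - w := by push_cast; ring
    exact e ▸ h1

theorem IsQuadBasis.exists_isStandardForm_of_ne_span (B : IsQuadBasis w t n) (hp : p.Prime)
    (hpP : (p : R) ∈ P) (htop : P ≠ ⊤) (hspan : P ≠ Ideal.span {(p : R)}) :
    ∃ x, IsStandardForm w 1 p x P := by
  obtain ⟨l, m, x, -, -, h⟩ := B.exists_isStandardForm_pow hp (k := 1) (by simpa using hpP)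
  have hdvd : p ^ (l + m) ∣ p ^ 1 := by
    have := (h.intCast_mem_iff B (u := p)).mp (by simpa using hpP)
    rw [← pow_add] at this
    rw [pow_one]
    exact_mod_cast this
  have hle : l + m ≤ 1 := (Nat.pow_dvd_pow_iff_le_right hp.one_lt).mp hdvd
  obtain ⟨rfl, rfl⟩ | ⟨rfl, rfl⟩ | ⟨rfl, rfl⟩ :
      (l = 0 ∧ m = 0) ∨ (l = 1 ∧ m = 0) ∨ (l = 0 ∧ m = 1) := by omega
  · exact absurd (h.eq (by simpa only [pow_zero] using IsStandardForm.top B x)) htop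
  · refine absurd (h.eq ?_) hspan
    simpa using IsStandardForm.span_singleton B p x
  · exact ⟨x, by simpa using h⟩

theorem IsQuadBasis.exists_span_eq_mul_of_simple_root (B : IsQuadBasis w t n) (hp : p.Prime)
    (hx : (p : ℤ) ∣ normForm t n x) (hx' : ¬ (p : ℤ) ∣ 2 * x + t) :
    ∃ P Q : Ideal R, P.IsPrime ∧ Q.IsPrime ∧ P ≠ Q ∧ Ideal.span {(p : R)} = P * Q := by
  obtain ⟨P, hP⟩ := B.exists_isStandardForm_of_dvd 1 hx
  obtain ⟨Q, hQ⟩ := B.exists_isStandardForm_of_dvd 1 (normForm_neg_sub t n x ▸ hx)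
  refine ⟨P, Q, (hP.isMaximal B hp).isPrime, (hQ.isMaximal B hp).isPrime, ?_, ?_⟩
  · rintro rfl
    have e : -x - t - x = -(2 * x + t) := by ring
    exact hx' (dvd_neg.mp (e ▸ hP.dvd_sub hQ B one_ne_zero))
  · obtain ⟨k, hk⟩ := hx
    have hcop : IsCoprime (p : ℤ) (2 * x + t) :=
      (Prime.coprime_iff_not_dvd (Nat.prime_iff_prime_int.mp hp)).mpr hx'
    rw [hP.mul_conj_eq hQ B hk, Int.cast_natCast]
    exact Int.isCoprime_iff_gcd_eq_one.mp
      (hcop.of_isCoprime_of_dvd_right (Int.gcd_dvd_left (2 * x + t) k))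

section Domain

variable [IsDomain R]

theorem IsQuadBasis.exists_isStandardForm_of_span_eq_mul (B : IsQuadBasis w t n) (hp : p.Prime)
    (hP : P ≠ ⊤) (hQ : Q ≠ ⊤) (h : Ideal.span {(p : R)} = P * Q) :
    ∃ x, IsStandardForm w 1 p x P := by
  have hpP : (p : R) ∈ P :=
    (Ideal.span_singleton_le_iff_mem P).mp (h.le.trans Ideal.mul_le_left)
  refine B.exists_isStandardForm_of_ne_span hp hpP hP fun hspan => hQ ?_
  have hmul : Ideal.span {(p : R)} * ⊤ = Ideal.span {(p : R)} * Q := by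
    rw [Ideal.mul_top, ← hspan, ← h, hspan]
  exact ((Ideal.span_singleton_mul_right_inj (B.natCast_ne_zero hp)).mp hmul).symm

theorem IsQuadBasis.exists_simple_root (B : IsQuadBasis w t n) (hp : p.Prime)
    (hP : P ≠ ⊤) (hQ : Q ≠ ⊤) (hPQ : P ≠ Q) (h : Ideal.span {(p : R)} = P * Q) :
    ∃ x, (p : ℤ) ∣ normForm t n x ∧ ¬ (p : ℤ) ∣ 2 * x + t := by
  obtain ⟨x, hPx⟩ := B.exists_isStandardForm_of_span_eq_mul hp hP hQ h
  obtain ⟨y, hQy⟩ := B.exists_isStandardForm_of_span_eq_mul hp hQ hP (h.trans (mul_comm P Q))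
  have hx := hPx.dvd_normForm B one_ne_zero
  refine ⟨x, hx, fun hx' => hPQ ?_⟩
  have hxy := (dvd_normForm_iff_of_double_root hp hx hx' y).mp (hQy.dvd_normForm B one_ne_zero)
  exact (hPx.congr hxy).eq hQy

theorem IsQuadBasis.exists_double_root (B : IsQuadBasis w t n) (hp : p.Prime) (hP : P ≠ ⊤)
    (h : Ideal.span {(p : R)} = P ^ 2) :
    ∃ x, ((p : ℤ) ∣ normForm t n x ∧ (p : ℤ) ∣ 2 * x + t) ∧ IsStandardForm w 1 p x P := by
  obtain ⟨x, hPx⟩ := B.exists_isStandardForm_of_span_eq_mul hp hP hP (h.trans (pow_two P))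
  have hx := hPx.dvd_normForm B one_ne_zero
  refine ⟨x, ⟨hx, ?_⟩, hPx⟩
  have hxP : (x : R) + w ∈ P := by simpa using hPx.mul_add_mem
  have hsq : ((x : R) + w) ^ 2 ∈ Ideal.span {((p : ℤ) : R)} := by
    rw [Int.cast_natCast, h]
    exact Ideal.pow_mem_pow hxP 2
  have hnorm : ((normForm t n x : ℤ) : R) ∈ Ideal.span {((p : ℤ) : R)} :=
    Ideal.mem_span_singleton.mpr (map_dvd (Int.castRingHom R) hx)
  refine B.dvd_of_add_mem_span (u := (2 * x + t) * x) ?_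
  convert add_mem hsq hnorm using 1
  rw [B.add_sq]
  push_cast
  ring

theorem IsStandardForm.not_sq_dvd_normForm (h : IsStandardForm w 1 p x P)
    (B : IsQuadBasis w t n) (hp : p.Prime) (hinv : Invertible P)
    (hx' : (p : ℤ) ∣ 2 * x + t) (u : ℤ) : ¬ (p : ℤ) ^ 2 ∣ normForm t n u := by
  rintro ⟨k, hk⟩
  rw [pow_two, mul_assoc] at hk
  have hux : (p : ℤ) ∣ u - x :=
    (dvd_normForm_iff_of_double_root hp (h.dvd_normForm B one_ne_zero) hx' u).mp ⟨_, hk⟩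
  have hu' : (p : ℤ) ∣ 2 * u + t := by
    have e : 2 * u + t = 2 * (u - x) + (2 * x + t) := by ring
    exact e ▸ (hux.mul_left 2).add hx'
  exact (Nat.prime_iff_prime_int.mp hp).not_isUnit
    ((h.congr hux).isUnit_of_dvd B hk hinv dvd_rfl hu' (dvd_mul_right _ _))

theorem IsQuadBasis.not_sq_dvd_normForm_of_eq_sq (B : IsQuadBasis w t n) (hp : p.Prime)
    (hP : P ≠ ⊤) (h : Ideal.span {(p : R)} = P ^ 2) (u : ℤ) :
    ¬ (p : ℤ) ^ 2 ∣ normForm t n u := by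
  obtain ⟨x, ⟨-, hx'⟩, hPx⟩ := B.exists_double_root hp hP h
  have hinv := invertible_of_mul_eq_span (B.natCast_ne_zero hp) ((pow_two P).symm.trans h.symm)
  exact hPx.not_sq_dvd_normForm B hp hinv hx' u

end Domain

theorem IsQuadBasis.exists_span_eq_mul_of_sq_dvd [IsDedekindDomain R] (B : IsQuadBasis w t n)
    (hp : p.Prime) (hx : (p : ℤ) ^ 2 ∣ normForm t n x) :
    ∃ P Q : Ideal R, P.IsPrime ∧ Q.IsPrime ∧ P ≠ Q ∧ Ideal.span {(p : R)} = P * Q := by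
  have hx1 := (dvd_pow_self _ two_ne_zero).trans hx
  refine B.exists_span_eq_mul_of_simple_root hp hx1 fun hx' => ?_
  obtain ⟨P, hP⟩ := B.exists_isStandardForm_of_dvd 1 hx1
  have hbot : P ≠ ⊥ := hP.ne_bot B (by simpa using hp.ne_zero)
  exact hP.not_sq_dvd_normForm B hp
    (isUnit_iff_ne_zero.mpr (FractionalIdeal.coeIdeal_ne_zero.mpr hbot)) hx' x hx

end Decomposition

/-! ### Quadratic fields -/

/-- The trace of `ω`. -/
def omegaTrace (d : ℤ) : ℤ := if d % 4 = 1 then 1 else 0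

/-- The norm of `ω`. -/
def omegaNorm (d : ℤ) : ℤ := if d % 4 = 1 then (1 - d) / 4 else -d

theorem isIntegral_of_sq_eq {R : Type*} [CommRing R] {θ : R} {T N : ℤ} (h : θ ^ 2 = T * θ - N) :
    IsIntegral ℤ θ := by
  refine ⟨Polynomial.X ^ 2 - Polynomial.C T * Polynomial.X + Polynomial.C N, by monicity!, ?_⟩
  simp only [Polynomial.eval₂_add, Polynomial.eval₂_sub, Polynomial.eval₂_mul,
    Polynomial.eval₂_X_pow, Polynomial.eval₂_X, Polynomial.eval₂_C]
  simp only [algebraMap_int_eq, eq_intCast]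
  linear_combination h

section NormTrace

variable {F A : Type*} [Field F] [CommRing A] [Algebra F A] {θ : A} {T N : F}

theorem leftMulMatrix_of_sq_eq (B : Module.Basis (Fin 2) F A) (hB : ⇑B = ![1, θ])
    (hsq : θ ^ 2 = T • θ - N • (1 : A)) :
    Algebra.leftMulMatrix B θ = !![0, -N; 1, T] := by
  have h0 : B 0 = 1 := by rw [hB]; rfl
  have h1 : B 1 = θ := by rw [hB]; rfl
  have hmul0 : B.repr (θ * B 0) = Finsupp.single 1 1 := by rw [h0, mul_one, ← h1, B.repr_self]
  have hmul1 : B.repr (θ * B 1) = T • Finsupp.single 1 1 - N • Finsupp.single 0 1 := by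
    rw [h1, ← sq, hsq, ← h0, ← h1, map_sub, map_smul, map_smul, B.repr_self, B.repr_self]
  ext i j
  rw [Algebra.leftMulMatrix_eq_repr_mul]
  fin_cases j
  · fin_cases i <;> simp [hmul0]
  · fin_cases i <;> simp [hmul1]

theorem leftMulMatrix_add_of_sq_eq (B : Module.Basis (Fin 2) F A) (hB : ⇑B = ![1, θ])
    (hsq : θ ^ 2 = T • θ - N • (1 : A)) (a b : F) :
    Algebra.leftMulMatrix B (a • (1 : A) + b • θ) = !![a, -(b * N); b, a + b * T] := by
  rw [map_add, map_smul, map_smul, map_one, leftMulMatrix_of_sq_eq B hB hsq]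
  ext i j
  fin_cases i <;> fin_cases j <;> simp

theorem exists_basis_one_of_finrank_eq_two [Nontrivial A] (hA : Module.finrank F A = 2)
    (hθ : ∀ q : F, q • (1 : A) ≠ θ) : ∃ B : Module.Basis (Fin 2) F A, ⇑B = ![1, θ] :=
  have hli := (LinearIndependent.pair_iff' one_ne_zero).mpr hθ
  ⟨basisOfLinearIndependentOfCardEqFinrank hli (by simp [hA]),
    coe_basisOfLinearIndependentOfCardEqFinrank hli _⟩

end NormTrace

section

variable {K : Type*} [Field K] [CharZero K] {d : ℤ} {δ θ : K} {T N : ℤ}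

theorem exists_eq_add_mul_of_finrank_eq_two (hK : Module.finrank ℚ K = 2)
    (hθ : ∀ q : ℚ, (q : K) ≠ θ) (y : K) : ∃ a b : ℚ, y = a + b * θ := by
  obtain ⟨B, hB⟩ := exists_basis_one_of_finrank_eq_two (F := ℚ) hK
    (by simpa [Rat.smul_def] using hθ)
  refine ⟨B.repr y 0, B.repr y 1, ?_⟩
  have h := B.sum_repr y
  rw [Fin.sum_univ_two, hB] at h
  simpa [Rat.smul_def] using h.symm

theorem norm_and_trace_add_mul (hK : Module.finrank ℚ K = 2) (hθ : ∀ q : ℚ, (q : K) ≠ θ)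
    (hsq : θ ^ 2 = T * θ - N) (a b : ℚ) :
    Algebra.norm ℚ ((a : K) + b * θ) = a ^ 2 + a * b * T + b ^ 2 * N ∧
      Algebra.trace ℚ K ((a : K) + b * θ) = 2 * a + b * T := by
  obtain ⟨B, hB⟩ := exists_basis_one_of_finrank_eq_two (F := ℚ) hK
    (by simpa [Rat.smul_def] using hθ)
  have hmat := leftMulMatrix_add_of_sq_eq (T := (T : ℚ)) (N := (N : ℚ)) B hB
    (by simpa [Rat.smul_def] using hsq) a b
  simp only [Rat.smul_def, mul_one] at hmat
  rw [Algebra.norm_eq_matrix_det B, Algebra.trace_eq_matrix_trace B, hmat,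
    Matrix.det_fin_two_of, Matrix.trace_fin_two_of]
  constructor <;> ring

theorem ratCast_ne_of_sq_eq (hd : Squarefree d) (hd1 : d ≠ 1) (hδ : δ ^ 2 = (d : K)) (q : ℚ) :
    (q : K) ≠ δ := by
  rintro rfl
  have h : q ^ 2 = (d : ℚ) := by exact_mod_cast hδ
  obtain ⟨k, rfl⟩ := Rat.isSquare_intCast_iff.mp ⟨q, by rw [← h, sq]⟩
  rcases Int.isUnit_iff.mp (hd k dvd_rfl) with rfl | rfl <;> simp at hd1

theorem omega_sq (hδ : δ ^ 2 = (d : K)) :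
    omega d δ ^ 2 = omegaTrace d * omega d δ - omegaNorm d := by
  unfold omega omegaTrace omegaNorm
  split_ifs with h
  · obtain ⟨e, he⟩ : (4 : ℤ) ∣ 1 - d := by omega
    have he' : (1 : K) - d = 4 * e := by exact_mod_cast congrArg (Int.cast (R := K)) he
    rw [he, Int.mul_ediv_cancel_left _ four_ne_zero]
    push_cast
    linear_combination (1 / 4 : K) * hδ - (1 / 4 : K) * he'
  · push_cast
    linear_combination hδ

theorem ratCast_ne_omega (hδ : ∀ q : ℚ, (q : K) ≠ δ) (q : ℚ) : (q : K) ≠ omega d δ := by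
  unfold omega
  split_ifs
  · intro h
    refine hδ (2 * q - 1) ?_
    push_cast
    linear_combination 2 * h
  · exact hδ q

theorem eq_zero_of_add_mul_eq_zero (hθ : ∀ q : ℚ, (q : K) ≠ θ) {a b : ℤ}
    (h : (a : K) + b * θ = 0) : a = 0 ∧ b = 0 := by
  obtain rfl : b = 0 := by
    by_contra hb
    have hb' : (b : K) ≠ 0 := by exact_mod_cast hb
    refine hθ (-a / b) ?_
    push_cast
    field_simp
    linear_combination -h
  exact ⟨by simpa using h, rfl⟩

theorem exists_tau_eq (d : ℤ) (δ : K) (f : ℕ) : ∃ c : ℤ, tau d δ f = c + f * omega d δ := by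
  unfold tau omega sqrtDK eps dK
  split_ifs with h
  · obtain ⟨c, hc⟩ : (2 : ℤ) ∣ (f * d) % 2 - f := by
      have : ((f : ℤ) * d) % 2 = (f : ℤ) % 2 := by
        rw [Int.mul_emod, show d % 2 = 1 by omega]
        simp
      omega
    have hc' : ((((f : ℤ) * d) % 2 : ℤ) : K) - f = 2 * c := by
      exact_mod_cast congrArg (Int.cast (R := K)) hc
    exact ⟨c, by linear_combination (1 / 2 : K) * hc'⟩
  · have heps : ((f : ℤ) * (4 * d)) % 2 = 0 := by
      rw [show (f : ℤ) * (4 * d) = 2 * (2 * f * d) by ring, Int.mul_emod_right]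
    refine ⟨0, ?_⟩
    rw [heps]
    push_cast
    ring

theorem exists_intCast_eq_of_squarefree_mul_sq (hd : Squarefree d) {b : ℚ} {k : ℤ}
    (h : d * b ^ 2 = k) : ∃ n : ℤ, b = n := by
  have hmul : d * b.num ^ 2 = (b.den : ℤ) ^ 2 * k := by
    have hden : (b.den : ℚ) ≠ 0 := by exact_mod_cast b.den_ne_zero
    rw [← Rat.num_div_den b] at h
    field_simp at h
    exact_mod_cast h
  have hcop : IsCoprime ((b.den : ℤ) ^ 2) (b.num ^ 2) :=
    (Int.isCoprime_iff_nat_coprime.mpr (by simpa using b.reduced.symm)).pow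
  have hunit := hd b.den (sq (b.den : ℤ) ▸ hcop.dvd_of_dvd_mul_right (Dvd.intro k hmul.symm))
  have hden : b.den = 1 := by simpa using Int.isUnit_iff_natAbs_eq.mp hunit
  exact ⟨b.num, ((Rat.den_eq_one_iff b).mp hden).symm⟩

theorem exists_half_add_eq_add_mul_omega (hd : Squarefree d) (δ : K) {A S M : ℤ}
    (h : A ^ 2 - d * S ^ 2 = 4 * M) :
    ∃ r s : ℤ, ((A : K) + S * δ) / 2 = r + s * omega d δ := by
  have hsq (x : ℤ) : x ^ 2 % 4 = x % 2 := by
    obtain ⟨k, rfl | rfl⟩ := x.even_or_odd'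
    · rw [mul_pow]
      omega
    · rw [Int.sq_mod_four_eq_one_of_odd (odd_two_mul_add_one k)]
      omega
  have hmod : A % 2 = d % 4 * (S % 2) % 4 := by
    rw [← hsq, ← hsq, ← Int.mul_emod]
    omega
  unfold omega
  split_ifs with hd4
  · obtain ⟨r, hr⟩ : (2 : ℤ) ∣ A - S := by
      rw [hd4, one_mul] at hmod
      omega
    have hr' : (A : K) - S = 2 * r := by exact_mod_cast congrArg (Int.cast (R := K)) hr
    exact ⟨r, S, by linear_combination (1 / 2 : K) * hr'⟩
  · have hd0 : d % 4 ≠ 0 := fun h0 => by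
      have := Int.isUnit_iff.mp (hd 2 (Int.dvd_of_emod_eq_zero h0))
      omega
    obtain ⟨⟨r, rfl⟩, ⟨s, rfl⟩⟩ : (2 : ℤ) ∣ A ∧ (2 : ℤ) ∣ S := by
      rcases S.emod_two_eq_zero_or_one with hS | hS <;> rw [hS] at hmod <;> omega
    exact ⟨r, s, by push_cast; ring⟩

theorem isIntegral_iff_exists_omega (hK : Module.finrank ℚ K = 2) (hd : Squarefree d)
    (hd1 : d ≠ 1) (hδ : δ ^ 2 = (d : K)) (y : K) :
    IsIntegral ℤ y ↔ ∃ r s : ℤ, y = r + s * omega d δ := by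
  constructor
  · intro hy
    have := Module.finite_of_finrank_eq_succ hK
    have hδ' := ratCast_ne_of_sq_eq hd hd1 hδ
    obtain ⟨a, b, rfl⟩ := exists_eq_add_mul_of_finrank_eq_two hK hδ' y
    obtain ⟨hnorm, htrace⟩ :=
      norm_and_trace_add_mul (T := 0) (N := -d) hK hδ' (by push_cast; linear_combination hδ) a b
    obtain ⟨M, hM⟩ := IsIntegrallyClosed.isIntegral_iff.mp (Algebra.isIntegral_norm ℚ hy)
    obtain ⟨A, hA⟩ := IsIntegrallyClosed.isIntegral_iff.mp (Algebra.isIntegral_trace (L := ℚ) hy)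
    rw [hnorm, algebraMap_int_eq, eq_intCast] at hM
    rw [htrace, algebraMap_int_eq, eq_intCast] at hA
    simp only [Int.cast_zero, Int.cast_neg, mul_zero, add_zero] at hM hA
    obtain ⟨S, hS⟩ := exists_intCast_eq_of_squarefree_mul_sq hd (b := 2 * b) (k := A ^ 2 - 4 * M)
      (by push_cast; rw [hM, hA]; ring)
    have hdisc : A ^ 2 - d * S ^ 2 = 4 * M := by
      have : (A : ℚ) ^ 2 - d * S ^ 2 = 4 * M := by
        rw [hM, hA, ← hS]
        ring
      exact_mod_cast this
    obtain ⟨r, s, hrs⟩ := exists_half_add_eq_add_mul_omega hd δ hdisc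
    have hA' : (A : K) = 2 * a := by exact_mod_cast congrArg (Rat.cast (K := K)) hA
    have hS' : 2 * (b : K) = S := by exact_mod_cast congrArg (Rat.cast (K := K)) hS
    exact ⟨r, s, by rw [← hrs, hA', ← hS']; ring⟩
  · rintro ⟨r, s, rfl⟩
    have hint (k : ℤ) : IsIntegral ℤ (k : K) := isIntegral_algebraMap (x := k)
    exact (hint r).add ((hint s).mul (isIntegral_of_sq_eq (omega_sq hδ)))

end

section

variable {K : Type*} [Field K] [CharZero K] {d : ℤ} {δ : K} {O : Subring K} {f : ℕ}

theorem exists_isQuadBasis_ringOfIntegers (hK : Module.finrank ℚ K = 2) (hd : Squarefree d)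
    (hd1 : d ≠ 1) (hδ : δ ^ 2 = (d : K)) :
    ∃ w : NumberField.RingOfIntegers K, IsQuadBasis w (omegaTrace d) (omegaNorm d) := by
  obtain ⟨w, hw⟩ : ∃ w : NumberField.RingOfIntegers K,
      algebraMap (NumberField.RingOfIntegers K) K w = omega d δ :=
    ⟨⟨omega d δ, isIntegral_of_sq_eq (omega_sq hδ)⟩, rfl⟩
  refine ⟨w, fun z => ?_, fun a b h => ?_, ?_⟩
  · obtain ⟨a, b, h⟩ := (isIntegral_iff_exists_omega hK hd hd1 hδ (z : K)).mp z.isIntegral_coe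
    exact ⟨a, b, NumberField.RingOfIntegers.ext (by simpa [hw] using h)⟩
  · have h' := congrArg (algebraMap (NumberField.RingOfIntegers K) K) h
    exact eq_zero_of_add_mul_eq_zero (ratCast_ne_omega (ratCast_ne_of_sq_eq hd hd1 hδ))
      (by simpa [hw] using h')
  · exact NumberField.RingOfIntegers.ext (by simpa [hw] using omega_sq hδ)

theorem intCast_mul_omega_mem_iff (hK : Module.finrank ℚ K = 2) (hd : Squarefree d)
    (hd1 : d ≠ 1) (hδ : δ ^ 2 = (d : K)) (hcond : HasConductor O f) (b : ℤ) :
    (b : K) * omega d δ ∈ O ↔ (f : ℤ) ∣ b := by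
  have hint := isIntegral_iff_exists_omega hK hd hd1 hδ
  constructor
  · intro hb
    have hbO : (b : K) ∈ conductor O := by
      intro y hy
      obtain ⟨r, s, rfl⟩ := (hint y).mp hy
      have e : (b : K) * (r + s * omega d δ) = (b * r : ℤ) + s * (b * omega d δ) := by
        push_cast
        ring
      exact e ▸ O.add_mem (intCast_mem O _) (O.mul_mem (intCast_mem O s) hb)
    rw [hcond] at hbO
    obtain ⟨y, hy, hby⟩ := hbO
    obtain ⟨r, s, rfl⟩ := (hint y).mp hy
    have hr := (eq_zero_of_add_mul_eq_zero (ratCast_ne_omega (ratCast_ne_of_sq_eq hd hd1 hδ))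
      (a := b - f * r) (b := -(f * s)) (by push_cast; linear_combination hby)).1
    exact ⟨r, sub_eq_zero.mp hr⟩
  · rintro ⟨k, rfl⟩
    have hf : (f : K) * omega d δ ∈ O := by
      have : (f : K) ∈ conductor O := hcond ▸ ⟨1, isIntegral_one, (mul_one _).symm⟩
      exact this _ (isIntegral_of_sq_eq (omega_sq hδ))
    have e : ((f * k : ℤ) : K) * omega d δ = k * (f * omega d δ) := by
      push_cast
      ring
    exact e ▸ O.mul_mem (intCast_mem O k) hf

theorem exists_isQuadBasis_order (hK : Module.finrank ℚ K = 2) (hd : Squarefree d)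
    (hd1 : d ≠ 1) (hδ : δ ^ 2 = (d : K)) (hO : O ≤ (integralClosure ℤ K).toSubring)
    (hf : f ≠ 0) (hcond : HasConductor O f) :
    ∃ θ : O, (θ : K) = f * omega d δ ∧
      IsQuadBasis θ (f * omegaTrace d) (f ^ 2 * omegaNorm d) := by
  have hmem := intCast_mul_omega_mem_iff hK hd hd1 hδ hcond
  have hθ : (f : K) * omega d δ ∈ O := by exact_mod_cast (hmem f).mpr dvd_rfl
  refine ⟨⟨f * omega d δ, hθ⟩, rfl, ?_, fun a b h => ?_, ?_⟩
  · rintro ⟨z, hz⟩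
    obtain ⟨a, b, rfl⟩ := (isIntegral_iff_exists_omega hK hd hd1 hδ z).mp (hO hz)
    have hb : (b : K) * omega d δ ∈ O := by
      simpa only [add_sub_cancel_left] using O.sub_mem hz (intCast_mem O a)
    obtain ⟨k, rfl⟩ := (hmem b).mp hb
    exact ⟨a, k, Subtype.ext (by push_cast; ring)⟩
  · have h' : (a : K) + b * (f * omega d δ) = 0 := by simpa using congrArg Subtype.val h
    obtain ⟨ha, hbf⟩ := eq_zero_of_add_mul_eq_zero
      (ratCast_ne_omega (ratCast_ne_of_sq_eq hd hd1 hδ)) (a := a) (b := b * f)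
      (by push_cast; linear_combination h')
    exact ⟨ha, (mul_eq_zero.mp hbf).resolve_right (by exact_mod_cast hf)⟩
  · refine Subtype.ext ?_
    push_cast
    linear_combination (f : K) ^ 2 * omega_sq hδ

end

theorem normDvd_iff {K : Type*} [Field K] [NumberField K] {d : ℤ} {δ : K}
    (hK : Module.finrank ℚ K = 2) (hd : Squarefree d) (hd1 : d ≠ 1)
    (hδ : δ ^ 2 = (d : K)) (f n : ℕ) (x : ℤ) :
    NormDvd n ((x : K) + f * omega d δ) ↔
      (n : ℤ) ∣ normForm (f * omegaTrace d) (f ^ 2 * omegaNorm d) x := by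
  have hnorm := (norm_and_trace_add_mul hK (ratCast_ne_omega (ratCast_ne_of_sq_eq hd hd1 hδ))
    (omega_sq hδ) x f).1
  rw [Rat.cast_intCast, Rat.cast_natCast] at hnorm
  unfold NormDvd
  rw [hnorm]
  refine exists_congr fun k => ?_
  have e : (x : ℚ) ^ 2 + x * f * omegaTrace d + (f : ℚ) ^ 2 * omegaNorm d =
      (normForm (f * omegaTrace d) (f ^ 2 * omegaNorm d) x : ℤ) := by
    unfold normForm
    push_cast
    ring
  rw [e]
  norm_cast

section

variable {K : Type*} [Field K] {O : Subring K} {p l m : ℕ} {x : ℤ} {q : Ideal O}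

theorem lattice_eq_primaryLattice (p : ℕ) (y τ : K) (s : ℤ) (h : y = s + τ) :
    lattice (p : K) y = primaryLattice p τ 0 1 s := by
  ext z
  simp [primaryLattice, h]

theorem carrier_eq_primaryLattice_iff (θ : O) :
    carrier q = primaryLattice p (θ : K) l m x ↔
      IsStandardForm θ ((p : ℤ) ^ l) ((p : ℤ) ^ m) x q := by
  have hlat : primaryLattice p (θ : K) l m x =
      Subtype.val '' {z : O | ∃ s t : ℤ, z = ((p : ℤ) ^ l : ℤ) * (((p : ℤ) ^ m : ℤ) * s +
        (x + θ) * t)} := by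
    ext y
    constructor
    · rintro ⟨_, ⟨s, t, rfl⟩, rfl⟩
      exact ⟨_, ⟨s, t, rfl⟩, by push_cast; rfl⟩
    · rintro ⟨_, ⟨s, t, rfl⟩, rfl⟩
      exact ⟨_, ⟨s, t, rfl⟩, by push_cast; rfl⟩
  rw [hlat, carrier, Subtype.val_injective.image_injective.eq_iff]
  exact Set.ext_iff

end

section NumberField

open NumberField

variable {K : Type*} [Field K] {p : ℕ}

section Decomposition

variable {w : 𝓞 K} {t n x : ℤ}

theorem Inert.not_dvd_normForm (h : Inert K p) (B : IsQuadBasis w t n) (hp : p.Prime) (x : ℤ) :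
    ¬ (p : ℤ) ∣ normForm t n x :=
  B.not_dvd_normForm_of_isPrime hp h x

theorem Ramified.exists_double_root (h : Ramified K p) (B : IsQuadBasis w t n) (hp : p.Prime) :
    ∃ x, (p : ℤ) ∣ normForm t n x ∧ (p : ℤ) ∣ 2 * x + t := by
  obtain ⟨P, hP, hsq⟩ := h
  exact (B.exists_double_root hp hP.ne_top hsq).imp fun _ hx => hx.1

theorem Ramified.not_sq_dvd_normForm (h : Ramified K p) (B : IsQuadBasis w t n) (hp : p.Prime)
    (x : ℤ) : ¬ (p : ℤ) ^ 2 ∣ normForm t n x := by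
  obtain ⟨P, hP, hsq⟩ := h
  exact B.not_sq_dvd_normForm_of_eq_sq hp hP.ne_top hsq x

theorem Splits.exists_simple_root (h : Splits K p) (B : IsQuadBasis w t n) (hp : p.Prime) :
    ∃ x, (p : ℤ) ∣ normForm t n x ∧ ¬ (p : ℤ) ∣ 2 * x + t := by
  obtain ⟨P, Q, hP, hQ, hPQ, hmul⟩ := h
  exact B.exists_simple_root hp hP.ne_top hQ.ne_top hPQ hmul

theorem splits_of_sq_dvd_normForm [NumberField K] (B : IsQuadBasis w t n) (hp : p.Prime)
    (hx : (p : ℤ) ^ 2 ∣ normForm t n x) : Splits K p :=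
  B.exists_span_eq_mul_of_sq_dvd hp hx

variable {f : ℕ}

theorem Inert.card_exactRoots_conductor (h : Inert K p) (B : IsQuadBasis w t n) (hp : p.Prime)
    (hf : f ≠ 0) :
    (exactRoots p (f * t) (f ^ 2 * n) (2 * padicValNat p f) (2 * padicValNat p f)).card =
        p ^ padicValNat p f ∧
      ∀ m, 2 * padicValNat p f + 1 ≤ m → (exactRoots p (f * t) (f ^ 2 * n) m m).card = 0 :=
  ⟨card_exactRoots_conductor_of_no_root hp hf (h.not_dvd_normForm B hp), fun _ hm =>
    Finset.card_eq_zero.mpr (exactRoots_conductor_eq_empty hp hf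
      (by simpa using h.not_dvd_normForm B hp) hm)⟩

theorem Ramified.card_exactRoots_conductor (h : Ramified K p) (B : IsQuadBasis w t n)
    (hp : p.Prime) (hf : f ≠ 0) (hpf : p ∣ f) :
    (exactRoots p (f * t) (f ^ 2 * n) (2 * padicValNat p f) (2 * padicValNat p f)).card =
        Nat.totient (p ^ padicValNat p f) ∧
      (exactRoots p (f * t) (f ^ 2 * n) (2 * padicValNat p f + 1)
        (2 * padicValNat p f + 1)).card = p ^ padicValNat p f ∧
      ∀ m, 2 * padicValNat p f + 1 < m → (exactRoots p (f * t) (f ^ 2 * n) m m).card = 0 := by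
  obtain ⟨x, hx, hx'⟩ := h.exists_double_root B hp
  have h2 := h.not_sq_dvd_normForm B hp
  exact ⟨card_exactRoots_conductor_of_double_root hp hf hpf hx hx',
    card_exactRoots_conductor_add_one_of_double_root hp hf hx hx' h2,
    fun m hm => Finset.card_eq_zero.mpr (exactRoots_conductor_eq_empty hp hf h2 hm)⟩

theorem Splits.card_exactRoots_conductor (h : Splits K p) (B : IsQuadBasis w t n) (hp : p.Prime)
    (hf : f ≠ 0) (hpf : p ∣ f) :
    (exactRoots p (f * t) (f ^ 2 * n) (2 * padicValNat p f) (2 * padicValNat p f)).card =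
        p ^ (padicValNat p f - 1) * (p - 2) ∧
      ∀ m, 2 * padicValNat p f + 1 ≤ m → (exactRoots p (f * t) (f ^ 2 * n) m m).card =
        2 * Nat.totient (p ^ padicValNat p f) := by
  obtain ⟨x, hx, hx'⟩ := h.exists_simple_root B hp
  exact ⟨card_exactRoots_conductor_of_simple_root hp hf hpf hx hx',
    fun m hm => card_exactRoots_conductor_of_simple_root_of_lt hp hf hpf hx hx' hm⟩

variable {R : Type*} [CommRing R] [IsDomain R] {θ : R} {T N s : ℤ} {P : Ideal R}

theorem IsSingularPrime.finite_atoms_of_not_splits [NumberField K]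
    (h : IsSingularPrime θ T N p s P) (B : IsQuadBasis w t n) (hf : f ≠ 0)
    (ht : 2 * s + T = f * t) (hn : normForm T N s = f ^ 2 * n) (hns : ¬ Splits K p) :
    {q : Ideal R | IsIdealAtom q ∧ q.radical = P}.Finite := by
  refine h.finite_atoms (M := 2 * padicValNat p f + 2) ?_
  rw [ht, hn]
  exact not_pow_dvd_normForm_conductor_mul h.prime hf
    fun _ => mt (splits_of_sq_dvd_normForm B h.prime) hns

theorem IsSingularPrime.finite_invertible_atoms_iff [NumberField K]
    (h : IsSingularPrime θ T N p s P) (B : IsQuadBasis w t n) (hf : f ≠ 0) (hpf : p ∣ f)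
    (ht : 2 * s + T = f * t) (hn : normForm T N s = f ^ 2 * n) :
    {q : Ideal R | IsIdealAtom q ∧ Invertible q ∧ q.radical = P}.Finite ↔ ¬ Splits K p := by
  refine ⟨fun hfin hs => ?_, fun hns => (h.finite_atoms_of_not_splits B hf ht hn hns).subset
    fun q hq => ⟨hq.1, hq.2.2⟩⟩
  refine h.infinite_invertible_atoms (M := 2 * padicValNat p f + 1) (fun m hm => ?_) hfin
  rw [ht, hn, ← Finset.card_pos, (hs.card_exactRoots_conductor B h.prime hf hpf).2 m hm]
  exact mul_pos two_pos (Nat.totient_pos.mpr (pow_pos h.prime.pos _))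

end Decomposition

theorem exists_isSingularPrime_order [NumberField K] {d : ℤ} {δ : K} {O : Subring K} {f : ℕ}
    (hK : Module.finrank ℚ K = 2) (hd : Squarefree d) (hd1 : d ≠ 1) (hδ : δ ^ 2 = (d : K))
    (hO : O ≤ (integralClosure ℤ K).toSubring)
    (hf : f ≠ 0) (hcond : HasConductor O f) (hp : p.Prime) (hpf : p ∣ f) :
    ∃ (θ : O) (T N s : ℤ) (P : Ideal O), (θ : K) = tau d δ f ∧
      IsSingularPrime θ T N p s P ∧ carrier P = lattice (p : K) (f * omega d δ) ∧
      2 * s + T = f * omegaTrace d ∧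
      normForm T N s = f ^ 2 * omegaNorm d ∧
      ∀ (m : ℕ) (x : ℤ), NormDvd (p ^ m) ((x : K) + θ) ↔ (p : ℤ) ^ m ∣ normForm T N x := by
  obtain ⟨θ, hθ, B⟩ := exists_isQuadBasis_order hK hd hd1 hδ hO hf hcond
  obtain ⟨c, hc⟩ := exists_tau_eq d δ f
  have hpf' : (p : ℤ) ∣ f := Int.natCast_dvd_natCast.mpr hpf
  obtain ⟨P, hP⟩ := B.exists_isSingularPrime hp (hpf'.mul_right _)
    ((pow_dvd_pow_of_dvd hpf' 2).mul_right _) c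
  have hτ : ((c + θ : O) : K) = c + f * omega d δ := by simp [hθ]
  refine ⟨c + θ, _, _, -c, P, hτ.trans hc.symm, hP, ?_, by ring, ?_, fun m x => ?_⟩
  · rw [lattice_eq_primaryLattice p _ ((c + θ : O) : K) (-c) (by simp [hτ])]
    exact (carrier_eq_primaryLattice_iff _).mpr (by simpa using hP.isStandardForm)
  · unfold normForm
    ring
  · have e : (x : K) + (c + θ : O) = (c + x : ℤ) + f * omega d δ := by
      rw [hτ]
      push_cast
      ring
    rw [e, normDvd_iff hK hd hd1 hδ, Nat.cast_pow, normForm_add]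

end NumberField

theorem IsSingularPrime.encard_invAtoms {K : Type*} [Field K] {O : Subring K} {θ : O} {T N s : ℤ}
    {p : ℕ} {P : Ideal O} (h : IsSingularPrime θ T N p s P) (m : ℕ) :
    (invAtoms O p (θ : K) m).encard =
      (exactRoots p (2 * s + T) (normForm T N s) m m).card := by
  rw [← h.encard_invertible_atoms]
  simp only [invAtoms, carrier_eq_primaryLattice_iff, pow_zero]

end QuadOrder

open QuadOrder in
theorem theorem3p6 {K : Type*} [Field K] [NumberField K] (hK : Module.finrank ℚ K = 2)
    (d : ℤ) (hd : Squarefree d) (hd1 : d ≠ 1) (δ : K) (hδ : δ ^ 2 = (d : K))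
    (O : Subring K) (hO : QuadOrder.IsOrder O)
    (f : ℕ) (hf : 2 ≤ f) (hcond : QuadOrder.HasConductor O f)
    (p : ℕ) (hp : p.Prime) (hpf : p ∣ f)
    (τ : K) (hτ : τ = QuadOrder.tau d δ f)
    (v : ℕ) (hv : v = padicValNat p f) :
    -- the ideal `𝔭 = pℤ + fωℤ`
    ∃ 𝔭 : Ideal O,
      QuadOrder.carrier 𝔭 = QuadOrder.lattice (p : K) ((f : K) * QuadOrder.omega d δ) ∧
      -- description of the primary ideals with radical `𝔭`, and their norms
      (∀ q : Ideal O, (q.IsPrimary ∧ q.radical = 𝔭) ↔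
        ∃ (l m : ℕ) (r : ℤ), 1 ≤ l + m ∧ 0 ≤ r ∧ r < (p : ℤ) ^ m ∧
          QuadOrder.NormDvd (p ^ m) ((r : K) + τ) ∧
          QuadOrder.carrier q = QuadOrder.primaryLattice p τ l m r) ∧
      (∀ (l m : ℕ) (r : ℤ), 1 ≤ l + m → 0 ≤ r → r < (p : ℤ) ^ m →
        QuadOrder.NormDvd (p ^ m) ((r : K) + τ) →
        ∃ q : Ideal O, QuadOrder.carrier q = QuadOrder.primaryLattice p τ l m r ∧
          QuadOrder.idealNorm q = p ^ (2 * l + m)) ∧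
      -- invertibility
      (∀ (q : Ideal O) (l m : ℕ) (r : ℤ), q.IsPrimary → q.radical = 𝔭 →
        QuadOrder.carrier q = QuadOrder.primaryLattice p τ l m r →
        (QuadOrder.Invertible q ↔
          (m = 0 ∨ ¬ QuadOrder.NormDvd (p ^ (m + 1)) ((r : K) + τ)))) ∧
      -- ideal atoms
      (∀ q : Ideal O, q.IsPrimary → q.radical = 𝔭 →
        (QuadOrder.IsIdealAtom q ↔
          (q = Ideal.span {(p : O)} ∨
            ∃ (m : ℕ) (r : ℤ), 1 ≤ m ∧ QuadOrder.NormDvd (p ^ m) ((r : K) + τ) ∧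
              QuadOrder.carrier q = QuadOrder.primaryLattice p τ 0 m r))) ∧
      -- numbers of invertible ideal atoms of norm `p ^ m`
      (∀ h : ℕ, 1 ≤ h → h < v →
        (QuadOrder.invAtoms O p τ (2 * h)).encard = (Nat.totient (p ^ h) : ℕ)) ∧
      (QuadOrder.Inert K p →
        (QuadOrder.invAtoms O p τ (2 * v)).encard = (p ^ v : ℕ) ∧
        ∀ m : ℕ, 2 * v + 1 ≤ m → (QuadOrder.invAtoms O p τ m).encard = 0) ∧
      (QuadOrder.Ramified K p →
        (QuadOrder.invAtoms O p τ (2 * v)).encard = (Nat.totient (p ^ v) : ℕ) ∧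
        (QuadOrder.invAtoms O p τ (2 * v + 1)).encard = (p ^ v : ℕ) ∧
        ∀ m : ℕ, 2 * v + 1 < m → (QuadOrder.invAtoms O p τ m).encard = 0) ∧
      (QuadOrder.Splits K p →
        (QuadOrder.invAtoms O p τ (2 * v)).encard = (p ^ (v - 1) * (p - 2) : ℕ) ∧
        ∀ m : ℕ, 2 * v + 1 ≤ m →
          (QuadOrder.invAtoms O p τ m).encard = (2 * Nat.totient (p ^ v) : ℕ)) ∧
      (∀ m : ℕ, m < 2 * v → (∀ h : ℕ, 1 ≤ h → h < v → m ≠ 2 * h) →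
        (QuadOrder.invAtoms O p τ m).encard = 0) ∧
      -- finiteness
      ({q : Ideal O | QuadOrder.IsIdealAtom q ∧ q.radical = 𝔭}.Finite ↔
        {q : Ideal O | QuadOrder.IsIdealAtom q ∧ QuadOrder.Invertible q ∧
          q.radical = 𝔭}.Finite) ∧
      ({q : Ideal O | QuadOrder.IsIdealAtom q ∧ QuadOrder.Invertible q ∧
          q.radical = 𝔭}.Finite ↔ ¬ QuadOrder.Splits K p) := by
  have hf0 : f ≠ 0 := by omega
  obtain ⟨w, B⟩ := exists_isQuadBasis_ringOfIntegers hK hd hd1 hδ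
  obtain ⟨θ, T, N, s, P, hθ, h, hP, ht, hn, hnorm⟩ :=
    exists_isSingularPrime_order hK hd hd1 hδ hO.le hf0 hcond hp hpf
  obtain rfl : τ = θ := hτ.trans hθ.symm
  subst hv
  have hfinite := h.finite_invertible_atoms_iff B hf0 hpf ht hn
  simp only [hnorm, carrier_eq_primaryLattice_iff, pow_zero, h.encard_invAtoms, ht, hn,
    Nat.cast_inj, Nat.cast_eq_zero]
  refine ⟨P, hP, fun q => ?_, fun l m r _ _ _ hr => ?_, fun q l m r _ _ hq => h.invertible_iff hq,
    fun q _ hrad => h.isIdealAtom_iff hrad,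
    fun k h1 hk => card_exactRoots_conductor_two_mul hp hf0 h1 hk _ _,
    fun hi => hi.card_exactRoots_conductor B hp hf0,
    fun hr => hr.card_exactRoots_conductor B hp hf0 hpf,
    fun hs => hs.card_exactRoots_conductor B hp hf0 hpf,
    fun m hm hne => Finset.card_eq_zero.mpr
      (exactRoots_conductor_eq_empty_of_lt hp hf0 hpf hm hne _ _),
    ⟨fun hfin => hfin.subset fun q hq => ⟨hq.1, hq.2.2⟩,
      fun hfin => h.finite_atoms_of_not_splits B hf0 ht hn (hfinite.mp hfin)⟩, hfinite⟩
  · rw [and_iff_right_of_imp h.isPrimary_of_radical_eq, h.radical_eq_iff_exists]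
  · obtain ⟨q, hq⟩ := h.isQuadBasis.exists_isStandardForm_of_dvd ((p : ℤ) ^ l) hr
    exact ⟨q, hq, h.idealNorm_eq hq⟩
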